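/- Let $m\ge 1$ and let $D=\{(x_1,\dots,x_m)\in\mathbb R^m : 0<x_1,\dots,x_m<1\}$ be the open unit cube, with closure $\overline D$ and boundary $\partial D$. Let $M$ be a (Hausdorff) smooth manifold of dimension $m$, let $U\subseteq M$ be open, and let $\varphi:U\to\mathbb R^m$ be a diffeomorphism. Let $F:\mathbb R^m\to\mathbb R$ be a smooth function that is equal to $1$ outside a compact subset of $\mathbb R^m$ and whose zero set $Z_F$ is nowhere dense, and put $Y=\varphi^{-1}(Z_F\cup\{0\})\subseteq M$. Suppose that $\partial D\subseteq Z_F\subseteq\overline D$. Let $M/Y$ be the quotient space of $M$ obtained by collapsing $Y$ to one point. For a topological space $X$ write $C_\infty(X)$ for the $C^*$-algebra of complex-valued continuous functions on $X$ vanishing at infinity, and $K_0,K_1$ for the $K$-groups of (not necessarily unital) $C^*$-algebras. Then there are isomorphisms of groups $$K_i\bigl(C_\infty(M/Y)\bigr)\;\cong\;K_i\bigl(C_\infty(M)\bigr)\oplus K_i\bigl(C_\infty(D\setminus Z_F)\bigr)\qquad\text{for } i=0,1.$$ -/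

import Mathlib

open scoped Manifold ContDiff ZeroAtInfty

namespace CStarK

/-! ### `K₀` -/

/-- An idempotent square matrix, of arbitrary finite size, with entries in the ring `R`. -/
structure IdemMat (R : Type*) [Ring R] where
  size : ℕ
  mat : Matrix (Fin size) (Fin size) R
  idem : mat * mat = mat

/-- Algebraic (Murray-von Neumann) equivalence of idempotent matrices, possibly of different
sizes: `e ∼ f` if `e = x y` and `f = y x` for some rectangular matrices `x`, `y`.  In particular
`e` is equivalent to `e ⊕ 0`, so no separate stabilization is needed. -/
def IdemMat.Rel {R : Type*} [Ring R] (e f : IdemMat R) : Prop :=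
  ∃ (x : Matrix (Fin e.size) (Fin f.size) R) (y : Matrix (Fin f.size) (Fin e.size) R),
    x * y = e.mat ∧ y * x = f.mat

theorem IdemMat.Rel.trans {R : Type*} [Ring R] {e f g : IdemMat R}
    (h₁ : e.Rel f) (h₂ : f.Rel g) : e.Rel g := by
  obtain ⟨x, y, hxy, hyx⟩ := h₁
  obtain ⟨z, w, hzw, hwz⟩ := h₂
  refine ⟨x * z, w * y, ?_, ?_⟩
  · calc x * z * (w * y) = x * (z * w) * y := by simp only [Matrix.mul_assoc]
      _ = (x * y) * (x * y) := by rw [hzw, ← hyx]; simp only [Matrix.mul_assoc]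
      _ = e.mat := by rw [hxy, e.idem]
  · calc w * y * (x * z) = w * (y * x) * z := by simp only [Matrix.mul_assoc]
      _ = (w * z) * (w * z) := by rw [hyx, ← hzw]; simp only [Matrix.mul_assoc]
      _ = g.mat := by rw [hwz, g.idem]

instance IdemMat.setoid (R : Type*) [Ring R] : Setoid (IdemMat R) where
  r := IdemMat.Rel
  iseqv :=
    { refl := fun e => ⟨e.mat, e.mat, e.idem, e.idem⟩
      symm := fun ⟨x, y, h₁, h₂⟩ => ⟨y, x, h₂, h₁⟩
      trans := IdemMat.Rel.trans }

/-- The block diagonal matrix `x ⊕ y`. -/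
def blockSum {R : Type*} [Ring R] {m n p q : ℕ} (x : Matrix (Fin m) (Fin p) R)
    (y : Matrix (Fin n) (Fin q) R) : Matrix (Fin (m + n)) (Fin (p + q)) R :=
  Matrix.reindex finSumFinEquiv finSumFinEquiv (Matrix.fromBlocks x 0 0 y)

theorem blockSum_mul {R : Type*} [Ring R] {m n p q r s : ℕ}
    (x : Matrix (Fin m) (Fin p) R) (y : Matrix (Fin n) (Fin q) R)
    (x' : Matrix (Fin p) (Fin r) R) (y' : Matrix (Fin q) (Fin s) R) :
    blockSum x y * blockSum x' y' = blockSum (x * x') (y * y') := by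
  simp [blockSum, Matrix.submatrix_mul_equiv, Matrix.fromBlocks_multiply]

theorem blockSum_assoc {R : Type*} [Ring R] {a b c : ℕ} (x : Matrix (Fin a) (Fin a) R)
    (y : Matrix (Fin b) (Fin b) R) (z : Matrix (Fin c) (Fin c) R) :
    blockSum x (blockSum y z) = (blockSum (blockSum x y) z).submatrix
      (finCongr (add_assoc a b c).symm) (finCongr (add_assoc a b c).symm) := by
  have h₁ : ∀ i : Fin a, Fin.cast (add_assoc a b c).symm (Fin.castAdd (b + c) i) =
      Fin.castAdd c (Fin.castAdd b i) := fun i => rfl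
  have h₂ : ∀ i : Fin b, Fin.cast (add_assoc a b c).symm (Fin.natAdd a (Fin.castAdd c i)) =
      Fin.castAdd c (Fin.natAdd a i) := fun i => rfl
  have h₃ : ∀ i : Fin c, Fin.cast (add_assoc a b c).symm (Fin.natAdd a (Fin.natAdd b i)) =
      Fin.natAdd (a + b) i := fun i => Fin.ext (by simp [add_assoc])
  ext i j
  induction i using Fin.addCases with
  | left i =>
    induction j using Fin.addCases with
    | left j => simp [blockSum, h₁]
    | right j => induction j using Fin.addCases <;> simp [blockSum, h₁, h₂, h₃]
  | right i =>
    induction i using Fin.addCases <;>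
    induction j using Fin.addCases with
    | left j => simp [blockSum, h₁, h₂, h₃]
    | right j => induction j using Fin.addCases <;> simp [blockSum, h₂, h₃]

theorem blockSum_comm {R : Type*} [Ring R] {a b : ℕ} (x : Matrix (Fin a) (Fin a) R)
    (y : Matrix (Fin b) (Fin b) R) :
    blockSum y x = (blockSum x y).submatrix
      (finSumFinEquiv.symm.trans ((Equiv.sumComm _ _).trans finSumFinEquiv))
      (finSumFinEquiv.symm.trans ((Equiv.sumComm _ _).trans finSumFinEquiv)) := by
  ext i j
  induction i using Fin.addCases <;> induction j using Fin.addCases <;> simp [blockSum]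

theorem zero_blockSum {R : Type*} [Ring R] {a : ℕ} (x : Matrix (Fin a) (Fin a) R)
    (y : Matrix (Fin 0) (Fin 0) R) :
    x = (blockSum y x).submatrix (finCongr (zero_add a).symm) (finCongr (zero_add a).symm) := by
  have h : ∀ i : Fin a, Fin.cast (zero_add a).symm i = Fin.natAdd 0 i :=
    fun i => Fin.ext (by simp)
  ext i j
  simp only [blockSum, Matrix.reindex_apply, Matrix.submatrix_apply, finCongr_apply, h,
    finSumFinEquiv_symm_apply_natAdd, Matrix.fromBlocks_apply₂₂]

theorem blockSum_map {R S : Type*} [Ring R] [Ring S] (φ : R →+* S) {a b : ℕ}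
    (x : Matrix (Fin a) (Fin a) R) (y : Matrix (Fin b) (Fin b) R) :
    blockSum (x.map φ) (y.map φ) = (blockSum x y).map φ := by
  ext i j
  induction i using Fin.addCases <;> induction j using Fin.addCases <;> simp [blockSum]

/-- The direct sum `e ⊕ f` of two idempotent matrices. -/
def IdemMat.sum {R : Type*} [Ring R] (e f : IdemMat R) : IdemMat R where
  size := e.size + f.size
  mat := blockSum e.mat f.mat
  idem := by rw [blockSum_mul, e.idem, f.idem]

/-- The empty matrix, as an idempotent. -/
def IdemMat.zero (R : Type*) [Ring R] : IdemMat R := ⟨0, 0, by simp⟩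

theorem IdemMat.rel_of_submatrix {R : Type*} [Ring R] {e f : IdemMat R}
    (σ : Fin f.size ≃ Fin e.size) (h : f.mat = e.mat.submatrix σ σ) : e.Rel f := by
  refine ⟨e.mat.submatrix id σ, e.mat.submatrix σ id, ?_, ?_⟩
  · rw [Matrix.submatrix_mul_equiv, e.idem, Matrix.submatrix_id_id]
  · rw [h, ← Matrix.submatrix_mul _ _ _ id _ Function.bijective_id, e.idem]

theorem IdemMat.Rel.sum {R : Type*} [Ring R] {e e' f f' : IdemMat R} (h : e.Rel e')
    (h' : f.Rel f') : (e.sum f).Rel (e'.sum f') := by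
  obtain ⟨x, y, h₁, h₂⟩ := h
  obtain ⟨z, w, h₃, h₄⟩ := h'
  exact ⟨blockSum x z, blockSum y w,
    (blockSum_mul x z y w).trans (congrArg₂ blockSum h₁ h₃),
    (blockSum_mul y w x z).trans (congrArg₂ blockSum h₂ h₄)⟩

theorem IdemMat.sum_comm {R : Type*} [Ring R] (e f : IdemMat R) : (e.sum f).Rel (f.sum e) :=
  IdemMat.rel_of_submatrix _ (blockSum_comm e.mat f.mat)

theorem IdemMat.zero_sum {R : Type*} [Ring R] (e : IdemMat R) : ((IdemMat.zero R).sum e).Rel e :=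
  IdemMat.rel_of_submatrix _ (zero_blockSum e.mat 0)

/-- The image of an idempotent matrix under a ring homomorphism applied to the entries. -/
def IdemMat.map {R S : Type*} [Ring R] [Ring S] (φ : R →+* S) (e : IdemMat R) : IdemMat S :=
  ⟨e.size, e.mat.map φ, by rw [← Matrix.map_mul, e.idem]⟩

theorem IdemMat.Rel.map {R S : Type*} [Ring R] [Ring S] (φ : R →+* S) {e f : IdemMat R}
    (h : e.Rel f) : (e.map φ).Rel (f.map φ) := by
  obtain ⟨x, y, h₁, h₂⟩ := h
  exact ⟨x.map φ, y.map φ, Matrix.map_mul.symm.trans (congrArg (·.map φ) h₁),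
    Matrix.map_mul.symm.trans (congrArg (·.map φ) h₂)⟩

/-- The semigroup of equivalence classes of idempotent matrices over `R`, under `⊕`. -/
def V (R : Type*) [Ring R] : Type _ := Quotient (IdemMat.setoid R)

instance V.addCommMonoid (R : Type*) [Ring R] : AddCommMonoid (V R) where
  add := Quotient.map₂ IdemMat.sum (fun _ _ h _ _ h' => IdemMat.Rel.sum h h')
  zero := Quotient.mk _ (IdemMat.zero R)
  add_assoc := by
    rintro ⟨e⟩ ⟨f⟩ ⟨g⟩
    exact Quotient.sound (IdemMat.rel_of_submatrix _ (blockSum_assoc e.mat f.mat g.mat))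
  zero_add := by
    rintro ⟨e⟩
    exact Quotient.sound (IdemMat.zero_sum e)
  add_zero := by
    rintro ⟨e⟩
    exact Quotient.sound ((IdemMat.sum_comm _ _).trans (IdemMat.zero_sum e))
  add_comm := by
    rintro ⟨e⟩ ⟨f⟩
    exact Quotient.sound (IdemMat.sum_comm e f)
  nsmul := @nsmulRec _ ⟨Quotient.mk _ (IdemMat.zero R)⟩
    ⟨Quotient.map₂ IdemMat.sum (fun _ _ h _ _ h' => IdemMat.Rel.sum h h')⟩

/-- The map `V R → V S` induced by a ring homomorphism, applied entrywise. -/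
def V.map {R S : Type*} [Ring R] [Ring S] (φ : R →+* S) : V R →+ V S where
  toFun := Quotient.map (IdemMat.map φ) (fun _ _ h => IdemMat.Rel.map φ h)
  map_zero' := Quotient.sound ⟨0, 0, Subsingleton.elim (α := Matrix (Fin 0) (Fin 0) S) _ _,
    Subsingleton.elim (α := Matrix (Fin 0) (Fin 0) S) _ _⟩
  map_add' := by
    rintro ⟨e⟩ ⟨f⟩
    exact Quotient.sound (IdemMat.rel_of_submatrix (Equiv.refl _) (blockSum_map φ e.mat f.mat))

/-- `K₀` of a unital ring: the Grothendieck group of `V R`. -/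
abbrev K0Unital (R : Type*) [Ring R] : Type _ := Algebra.GrothendieckAddGroup (V R)

/-- Functoriality of `K₀` for unital homomorphisms. -/
noncomputable def K0Unital.map {R S : Type*} [Ring R] [Ring S] (φ : R →+* S) :
    K0Unital R →+ K0Unital S :=
  Algebra.GrothendieckAddGroup.lift (Algebra.GrothendieckAddGroup.of.comp (V.map φ))

/-- The augmentation `A⁺ → ℂ`, `(λ, a) ↦ λ`, of the unitization `A⁺ = ℂ ⊕ A`. -/
noncomputable def aug (A : Type*) [NonUnitalCStarAlgebra A] : Unitization ℂ A →+* ℂ :=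
  (Unitization.fstHom ℂ A).toRingHom

/-- `K₀(A)` of a (not necessarily unital) C⋆-algebra: the kernel of `K₀(A⁺) → K₀(ℂ)`. -/
abbrev K0 (A : Type*) [NonUnitalCStarAlgebra A] : Type _ := (K0Unital.map (aug A)).ker

/-! ### `K₁` -/

/-- `GLₙ(A)` for a (not necessarily unital) C⋆-algebra `A`: the group of invertible `n × n`
matrices over `A⁺` that are congruent to the identity matrix modulo `A`, with the topology
it inherits as a group of units of the matrix algebra over `A⁺`. -/
noncomputable abbrev GLn (n : ℕ) (A : Type*) [NonUnitalCStarAlgebra A] :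
    Subgroup (Matrix (Fin n) (Fin n) (Unitization ℂ A))ˣ :=
  (Units.map ((aug A).mapMatrix (m := Fin n)).toMonoidHom).ker

/-- The `N × N` matrix `u ⊕ 1`, for an `n × n` matrix `u` with `n ≤ N`. -/
def padMat {R : Type*} [Ring R] {n N : ℕ} (_h : n ≤ N) (u : Matrix (Fin n) (Fin n) R) :
    Matrix (Fin N) (Fin N) R :=
  Matrix.of fun i j =>
    if hij : (i : ℕ) < n ∧ (j : ℕ) < n then u ⟨i, hij.1⟩ ⟨j, hij.2⟩ else if i = j then 1 else 0

theorem padMat_eq_blockSum {R : Type*} [Ring R] {n k : ℕ} (h : n ≤ n + k)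
    (u : Matrix (Fin n) (Fin n) R) : padMat h u = blockSum u (1 : Matrix (Fin k) (Fin k) R) := by
  ext i j
  induction i using Fin.addCases <;> induction j using Fin.addCases <;>
  simp [blockSum, padMat, Matrix.one_apply, Fin.ext_iff] <;> omega

/-- The stabilization `u ↦ u ⊕ 1` from `n × n` to `N × N` matrices, `n ≤ N`. -/
def pad {R : Type*} [Ring R] {n N : ℕ} (h : n ≤ N) :
    Matrix (Fin n) (Fin n) R →* Matrix (Fin N) (Fin N) R where
  toFun := padMat h
  map_one' := by
    ext i j
    by_cases hij : i = j
    · subst hij; simp [padMat]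
    · have : (i : ℕ) ≠ j := fun h => hij (Fin.ext h)
      simp [padMat, Matrix.one_apply, hij, this]
  map_mul' u v := by
    obtain ⟨k, rfl⟩ := Nat.exists_eq_add_of_le h
    rw [padMat_eq_blockSum, padMat_eq_blockSum, padMat_eq_blockSum, blockSum_mul, one_mul]

theorem pad_self {R : Type*} [Ring R] {n : ℕ} (u : Matrix (Fin n) (Fin n) R) :
    pad le_rfl u = u := by
  ext i j
  simp [pad, padMat]

theorem pad_pad {R : Type*} [Ring R] {n k N : ℕ} (h : n ≤ k) (h' : k ≤ N)
    (u : Matrix (Fin n) (Fin n) R) : pad h' (pad h u) = pad (h.trans h') u := by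
  ext i j
  simp only [pad, padMat, MonoidHom.coe_mk, OneHom.coe_mk, Matrix.of_apply, Fin.ext_iff]
  split_ifs <;> first | rfl | omega

theorem pad_map {R S : Type*} [Ring R] [Ring S] (φ : R →+* S) {n N : ℕ} (h : n ≤ N)
    (u : Matrix (Fin n) (Fin n) R) : (pad h u).map φ = pad h (u.map φ) := by
  ext i j
  simp only [pad, padMat, MonoidHom.coe_mk, OneHom.coe_mk, Matrix.of_apply, Matrix.map_apply]
  split_ifs <;> simp

theorem continuous_pad {R : Type*} [Ring R] [TopologicalSpace R] {n N : ℕ} (h : n ≤ N) :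
    Continuous (pad (R := R) h) := by
  refine continuous_matrix fun i j => ?_
  simp only [pad, padMat, MonoidHom.coe_mk, OneHom.coe_mk, Matrix.of_apply]
  split_ifs <;> fun_prop

/-- The stabilization homomorphism `GLₙ(A) → GL_N(A)`, `u ↦ u ⊕ 1`. -/
noncomputable def GLn.pad {n N : ℕ} (h : n ≤ N) (A : Type*) [NonUnitalCStarAlgebra A] :
    GLn n A →* GLn N A :=
  ((Units.map (CStarK.pad h)).comp (GLn n A).subtype).codRestrict (GLn N A) (by
    rintro ⟨u, hu⟩
    have hu' : (u.val).map (aug A) = 1 := congrArg Units.val hu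
    refine Units.ext ?_
    change (CStarK.pad h u.val).map (aug A) = 1
    rw [pad_map, hu', map_one])

theorem GLn.continuous_pad {n N : ℕ} (h : n ≤ N) (A : Type*) [NonUnitalCStarAlgebra A] :
    Continuous (GLn.pad h A) :=
  (((CStarK.continuous_pad h).units_map _).comp continuous_subtype_val).subtype_mk _

/-- The connected component `GLₙ(A)₀` of the identity in `GLₙ(A)`. -/
noncomputable abbrev GLnZero (n : ℕ) (A : Type*) [NonUnitalCStarAlgebra A] : Subgroup (GLn n A) :=
  Subgroup.connectedComponentOfOne (GLn n A)

instance GLnZero.normal (n : ℕ) (A : Type*) [NonUnitalCStarAlgebra A] : (GLnZero n A).Normal where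
  conj_mem u hu g := by
    have hc : Continuous fun v : GLn n A => g * v * g⁻¹ := by fun_prop
    have := hc.image_connectedComponent_subset 1 ⟨u, hu, rfl⟩
    rwa [mul_one, mul_inv_cancel] at this

/-- The group `GLₙ(A) / GLₙ(A)₀`. -/
abbrev GLnQuot (A : Type*) [NonUnitalCStarAlgebra A] (n : ℕ) : Type _ := GLn n A ⧸ GLnZero n A

/-- The map `GLₙ(A) / GLₙ(A)₀ → GL_N(A) / GL_N(A)₀` induced by stabilization. -/
noncomputable def GLnQuot.map (A : Type*) [NonUnitalCStarAlgebra A] (n N : ℕ) (h : n ≤ N) :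
    GLnQuot A n →* GLnQuot A N :=
  QuotientGroup.map _ _ (GLn.pad h A) (by
    intro u hu
    have := (GLn.continuous_pad h A).image_connectedComponent_subset 1 ⟨u, hu, rfl⟩
    rwa [map_one] at this)

instance GLnQuot.directedSystem (A : Type*) [NonUnitalCStarAlgebra A] :
    DirectedSystem (GLnQuot A) (fun n N h => GLnQuot.map A n N h) where
  map_self n := by
    rintro ⟨u⟩
    exact congrArg _ (Subtype.ext (Units.ext (pad_self _)))
  map_map n k N h h' := by
    rintro ⟨u⟩
    exact congrArg _ (Subtype.ext (Units.ext (pad_pad _ _ _)))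

/-- `K₁(A) = lim GLₙ(A) / GLₙ(A)₀` of a (not necessarily unital) C⋆-algebra, the direct limit
along `u ↦ u ⊕ 1`, with the group operation written additively. -/
abbrev K1 (A : Type*) [NonUnitalCStarAlgebra A] : Type _ :=
  Additive (DirectLimit (GLnQuot A) (GLnQuot.map A))

end CStarK

/-! ### The topological data -/

/-- The equivalence relation on `X` identifying all points of the subset `Y` with each other. -/
def CollapseSetoid {X : Type*} (Y : Set X) : Setoid X where
  r x y := x = y ∨ (x ∈ Y ∧ y ∈ Y)
  iseqv :=
    { refl := fun _ => Or.inl rfl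
      symm := by rintro x y (h | h); exacts [Or.inl h.symm, Or.inr h.symm]
      trans := by
        rintro x y z (rfl | h) (rfl | h')
        exacts [Or.inl rfl, Or.inr h', Or.inr h, Or.inr ⟨h.1, h'.2⟩] }

/-- The quotient space `X / Y` obtained by collapsing `Y` to one point, with the quotient
topology. -/
abbrev Collapse {X : Type*} [TopologicalSpace X] (Y : Set X) : Type _ :=
  Quotient (CollapseSetoid Y)

/-- The zero set of a real-valued function. -/
def zeroSet {X : Type*} (F : X → ℝ) : Set X := {x | F x = 0}

/-- The space `𝓕_m` of smooth real-valued functions on `ℝᵐ` that are equal to `1` outside a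
compact set and whose zero set is nowhere dense. -/
def FSpace (m : ℕ) : Set (EuclideanSpace ℝ (Fin m) → ℝ) :=
  {F | ContDiff ℝ ∞ F ∧ (∃ K : Set (EuclideanSpace ℝ (Fin m)), IsCompact K ∧ ∀ x ∉ K, F x = 1) ∧
    IsNowhereDense (zeroSet F)}

/-- The open unit cube in `ℝᵐ`. -/
def openCube (m : ℕ) : Set (EuclideanSpace ℝ (Fin m)) := {x | ∀ i, 0 < x i ∧ x i < 1}

/-! Since `frontier (openCube m) ⊆ zeroSet F ⊆ closure (openCube m)`, the closed cube is the union
of the open cube `D` and the zero set, and the origin, a corner of the cube, already lies in the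
zero set. Hence, regarded in `M` through the chart, `Y` is the zero set and `D ∪ Y` is a closed
ball. Collapsing that ball gives back `M`: a radial map `Φ : M → M`, supported in the chart, has `D
∪ Y` as its only nontrivial fibre (`exists_collapse_ball`).

So `M / Y` is a wedge of `M` with a compact piece whose complement of the base point is `D \ Y`. In
detail, `Φ` induces a proper map `P : M / Y → M`. The map that sends `D ∪ Y` to the base point and
every other point to its class descends along `Φ` to a proper section `T : M → M / Y`, so that `P ∘
T = id`. The functions on `M / Y` killed by `T*` are those vanishing off `D \ Y`, that is, the
extensions by zero of functions in `C₀(D \ Y)`. This gives a split exact sequence `0 → C₀(D \ Y) →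
C₀(M / Y) → C₀(M) → 0` (`exists_splitExact_collapse`).

It remains that `K₀` and `K₁` carry split exact sequences to direct sums. The splitting makes this
elementary, with no boundary maps or lifting of paths. For `K₀`, the equivalences of idempotents
over `A⁺` are corrected by `s ∘ p` until their entries lie in `J⁺` (`SplitSquare.K0_injective`,
`SplitSquare.K0_exact`). For `K₁`, the map `a ↦ a · s(p(a))⁻¹` is a continuous retraction of
`GLₙ(A)` onto `GLₙ(J)`, so identity components correspond (`SplitExact.mem_GLnZero_of_map_mem`). -/

/-- A split short exact sequence of (not necessarily commutative) groups in which the two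
sub-quotients commute with each other is a direct product. -/
theorem AddMonoidHom.nonempty_addEquiv_prod_of_split {G H N : Type*} [AddGroup G] [AddGroup H]
    [AddGroup N] (i : N →+ G) (p : G →+ H) (s : H →+ G)
    (comm : ∀ b j, AddCommute (s b) (i j)) (hps : ∀ b, p (s b) = b) (hpi : ∀ j, p (i j) = 0)
    (hi : ∀ j, i j = 0 → j = 0) (hex : ∀ a, p a = 0 → ∃ j, i j = a) :
    Nonempty (G ≃+ H × N) := by
  refine ⟨(AddEquiv.ofBijective (AddMonoidHom.noncommCoprod s i comm) ⟨?_, ?_⟩).symm⟩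
  · rw [injective_iff_map_eq_zero]
    rintro ⟨b, j⟩ h
    rw [AddMonoidHom.noncommCoprod_apply] at h
    have hb : b = 0 := by
      have := congrArg p h
      rwa [map_add, hps, hpi, add_zero, map_zero] at this
    subst hb
    rw [map_zero, zero_add] at h
    rw [hi j h]
    rfl
  · intro a
    -- The order of the two terms matters, as `G` need not be commutative: it makes `s (p a) + i j =
    -- a`.
    obtain ⟨j, hj⟩ := hex (-s (p a) + a) (by rw [map_add, map_neg, hps, neg_add_cancel])
    exact ⟨(p a, j), by rw [AddMonoidHom.noncommCoprod_apply, hj, add_neg_cancel_left]⟩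

namespace CStarK

/-! ### Split exactness of `K₀` -/

/-- The identity matrix of size `n`, as an idempotent. -/
def IdemMat.one (R : Type*) [Ring R] (n : ℕ) : IdemMat R := ⟨n, 1, one_mul 1⟩

/-- The class of the free module of rank `n` in `V R`. -/
def V.unit (R : Type*) [Ring R] (n : ℕ) : V R := Quotient.mk _ (IdemMat.one R n)

theorem blockSum_one {R : Type*} [Ring R] (m n : ℕ) :
    blockSum (1 : Matrix (Fin m) (Fin m) R) (1 : Matrix (Fin n) (Fin n) R) = 1 := by
  simp [blockSum]

theorem V.unit_add {R : Type*} [Ring R] (m n : ℕ) :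
    V.unit R m + V.unit R n = V.unit R (m + n) :=
  Quotient.sound (IdemMat.rel_of_submatrix (Equiv.refl _) (blockSum_one m n).symm)

theorem V.map_unit {R S : Type*} [Ring R] [Ring S] (φ : R →+* S) (n : ℕ) :
    V.map φ (V.unit R n) = V.unit S n :=
  Quotient.sound (IdemMat.rel_of_submatrix (Equiv.refl _)
    (Matrix.map_one φ (map_zero φ) (map_one φ)).symm)

theorem V.map_mk {R S : Type*} [Ring R] [Ring S] (φ : R →+* S) (e : IdemMat R) :
    V.map φ (Quotient.mk _ e) = Quotient.mk _ (e.map φ) := rfl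

theorem V.map_map {R S T : Type*} [Ring R] [Ring S] [Ring T] (φ : R →+* S) (ψ : S →+* T)
    (v : V R) : V.map ψ (V.map φ v) = V.map (ψ.comp φ) v := by
  obtain ⟨e⟩ := v
  rfl

theorem V.map_id {R : Type*} [Ring R] (v : V R) : V.map (RingHom.id R) v = v := by
  obtain ⟨e⟩ := v
  rfl

/-- Every idempotent is a direct summand of an identity matrix. -/
theorem V.exists_add_eq_unit {R : Type*} [Ring R] (v : V R) :
    ∃ w n, v + w = V.unit R n := by
  obtain ⟨⟨N, E, hE⟩⟩ := v
  have hE' : (1 - E) * (1 - E) = 1 - E := by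
    rw [mul_sub, mul_one, sub_mul, hE, one_mul, sub_self, sub_zero]
  have h₁ : (Matrix.fromRows E (1 - E)).submatrix finSumFinEquiv.symm id *
      (Matrix.fromCols E (1 - E)).submatrix id finSumFinEquiv.symm = blockSum E (1 - E) := by
    rw [← Matrix.submatrix_mul _ _ _ id _ Function.bijective_id, Matrix.fromRows_mul_fromCols, hE,
      hE', mul_sub, mul_one, sub_mul, one_mul, hE, sub_self]
    rfl
  have h₂ : (Matrix.fromCols E (1 - E)).submatrix id finSumFinEquiv.symm *
      (Matrix.fromRows E (1 - E)).submatrix finSumFinEquiv.symm id = 1 := by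
    rw [Matrix.submatrix_mul_equiv, Matrix.fromCols_mul_fromRows, hE, hE', add_sub_cancel,
      Matrix.submatrix_id_id]
  exact ⟨Quotient.mk _ ⟨N, 1 - E, hE'⟩, N, Quotient.sound ⟨_, _, h₁, h₂⟩⟩

/-- The canonical map `V R → K₀ R`. -/
noncomputable abbrev K0Unital.of {R : Type*} [Ring R] : V R →+ K0Unital R :=
  Algebra.GrothendieckAddGroup.of

theorem K0Unital.map_of {R S : Type*} [Ring R] [Ring S] (φ : R →+* S) (v : V R) :
    K0Unital.map φ (K0Unital.of v) = K0Unital.of (V.map φ v) :=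
  DFunLike.congr_fun (Algebra.GrothendieckAddGroup.lift.symm_apply_apply
    (Algebra.GrothendieckAddGroup.of.comp (V.map φ))) v

/-- In a formal difference `a - b`, adding a complement of `b` to both terms makes the second one
free. -/
theorem K0Unital.exists_of_sub_unit {R : Type*} [Ring R] (x : K0Unital R) :
    ∃ v n, x = K0Unital.of v - K0Unital.of (V.unit R n) := by
  obtain ⟨⟨a, b⟩, h⟩ := (AddLocalization.addMonoidOf (⊤ : AddSubmonoid (V R))).surj x
  obtain ⟨w, n, hw⟩ := V.exists_add_eq_unit b.1
  have hx : x + K0Unital.of b.1 = K0Unital.of a := h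
  refine ⟨a + w, n, ?_⟩
  rw [← hw, map_add, map_add, ← hx]
  abel

/-- Equality in the Grothendieck group means equality after adding some `c`; a complement of `c`
turns it into a free summand. -/
theorem K0Unital.of_eq_of {R : Type*} [Ring R] {v w : V R}
    (h : K0Unital.of v = K0Unital.of w) : ∃ n, v + V.unit R n = w + V.unit R n := by
  obtain ⟨c, hc⟩ := (AddLocalization.addMonoidOf
    (⊤ : AddSubmonoid (V R))).eq_iff_exists.1 h
  obtain ⟨d, n, hd⟩ := V.exists_add_eq_unit c.1
  refine ⟨n, ?_⟩
  rw [← hd, ← add_assoc, ← add_assoc, add_comm v, hc, add_comm w]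

theorem K0Unital.map_map {R S T : Type*} [Ring R] [Ring S] [Ring T] (φ : R →+* S) (ψ : S →+* T)
    (x : K0Unital R) :
    K0Unital.map ψ (K0Unital.map φ x) = K0Unital.map (ψ.comp φ) x := by
  obtain ⟨v, n, rfl⟩ := K0Unital.exists_of_sub_unit x
  simp only [map_sub, K0Unital.map_of, V.map_map]

theorem K0Unital.map_id {R : Type*} [Ring R] (x : K0Unital R) :
    K0Unital.map (RingHom.id R) x = x := by
  obtain ⟨v, n, rfl⟩ := K0Unital.exists_of_sub_unit x
  simp only [map_sub, K0Unital.map_of, V.map_id]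

/-- A ring homomorphism `p : A → B` split by `s`, together with the inclusion `i : J → A` of the
subring of those elements which `p` maps to the image of the central ring of scalars `k`. -/
structure SplitSquare {J A B k : Type*} [Ring J] [Ring A] [Ring B] [Ring k] (i : J →+* A)
    (p : A →+* B) (s : B →+* A) (ε : J →+* k) (ι : k →+* J) : Prop where
  injective : Function.Injective i
  p_s : ∀ b, p (s b) = b
  ε_ι : ∀ c, ε (ι c) = c
  s_p : ∀ c, s (p (i (ι c))) = i (ι c)
  p_i : ∀ j, p (i j) = p (i (ι (ε j)))
  lift : ∀ a c, p a = p (i (ι c)) → ∃ j, i j = a ∧ ε j = c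

namespace SplitSquare

variable {J A B k : Type*} [Ring J] [Ring A] [Ring B] [Ring k] {i : J →+* A}
    {p : A →+* B} {s : B →+* A} {ε : J →+* k} {ι : k →+* J}

/-- This is how every matrix over `J` is produced below: it suffices that its image over `B` is the
prescribed scalar matrix. -/
theorem lift_matrix (H : SplitSquare i p s ε ι) {m n : Type*} (X : Matrix m n A)
    (C : Matrix m n k) (h : X.map p = ((C.map ι).map i).map p) :
    ∃ Y : Matrix m n J, Y.map i = X ∧ Y.map ε = C := by
  have h' : ∀ a b, ∃ j, i j = X a b ∧ ε j = C a b := fun a b =>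
    H.lift _ _ (congrFun (congrFun h a) b)
  choose Y hY using h'
  exact ⟨Matrix.of Y, Matrix.ext fun a b => (hY a b).1, Matrix.ext fun a b => (hY a b).2⟩

theorem matrix_injective (H : SplitSquare i p s ε ι) {m n : Type*} {X Y : Matrix m n J}
    (h : X.map i = Y.map i) : X = Y :=
  Matrix.map_injective H.injective h

theorem map_p_map_i (H : SplitSquare i p s ε ι) {m n : Type*} (X : Matrix m n J) :
    (X.map i).map p = (((X.map ε).map ι).map i).map p :=
  Matrix.ext fun _ _ => H.p_i _

theorem map_s_map_p (H : SplitSquare i p s ε ι) {m n : Type*} (X : Matrix m n J) :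
    ((X.map i).map p).map s = ((X.map ε).map ι).map i := by
  rw [H.map_p_map_i]
  exact Matrix.ext fun _ _ => H.s_p _

theorem map_p_map_s (H : SplitSquare i p s ε ι) {m n : Type*} (X : Matrix m n B) :
    (X.map s).map p = X :=
  Matrix.ext fun _ _ => H.p_s _

/-- An idempotent over `J` that becomes trivial over `A` comes from the scalars. -/
theorem eq_map_of_map_eq_unit (H : SplitSquare i p s ε ι) {v : V J} {n : ℕ}
    (h : V.map i v = V.unit A n) : v = V.map ι (V.map ε v) := by
  obtain ⟨⟨N, E, hE⟩⟩ := v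
  obtain ⟨P, Q, hPQ, hQP⟩ := Quotient.exact h
  change Matrix (Fin N) (Fin n) A at P
  change Matrix (Fin n) (Fin N) A at Q
  change P * Q = E.map i at hPQ
  change Q * P = 1 at hQP
  have hone : ∀ f : A →+* B, (1 : Matrix (Fin n) (Fin n) A).map f = 1 := fun f =>
    Matrix.map_one f (map_zero f) (map_one f)
  have hone' : (1 : Matrix (Fin n) (Fin n) B).map s = 1 :=
    Matrix.map_one s (map_zero s) (map_one s)
  have hpp : P.map p * Q.map p = (((E.map ε).map ι).map i).map p := by
    rw [← Matrix.map_mul, hPQ, H.map_p_map_i]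
  -- The matrices `P` and `Q` need not come from `J`. Multiplying by `s(p(Q))` on the right of `P`,
  -- and by `s(p(P))` on the left of `Q`, gives products whose images in `B` are both the scalar
  -- matrix `p(P) p(Q)`. The relation `QP = 1` then yields `YZ = E`, while `ZY` becomes the scalar
  -- part of `E`.
  obtain ⟨Y, hY, -⟩ := H.lift_matrix (P * (Q.map p).map s) (E.map ε) (by
    rw [Matrix.map_mul, H.map_p_map_s, hpp])
  obtain ⟨Z, hZ, -⟩ := H.lift_matrix ((P.map p).map s * Q) (E.map ε) (by
    rw [Matrix.map_mul, H.map_p_map_s, hpp])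
  have hYZ : Y * Z = E := H.matrix_injective <| by
    rw [Matrix.map_mul, hY, hZ]
    calc P * (Q.map p).map s * ((P.map p).map s * Q)
        = P * ((Q.map p).map s * (P.map p).map s) * Q := by simp only [Matrix.mul_assoc]
      _ = E.map i := by
        rw [← Matrix.map_mul, ← Matrix.map_mul, hQP, hone, hone', Matrix.mul_one, hPQ]
  have hZY : Z * Y = (E.map ε).map ι := H.matrix_injective <| by
    rw [Matrix.map_mul, hY, hZ]
    calc (P.map p).map s * Q * (P * (Q.map p).map s)
        = (P.map p).map s * (Q * P) * (Q.map p).map s := by simp only [Matrix.mul_assoc]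
      _ = ((E.map ε).map ι).map i := by
        rw [hQP, Matrix.mul_one, ← Matrix.map_mul, ← Matrix.map_mul, hPQ, H.map_s_map_p]
  exact Quotient.sound ⟨Y, Z, hYZ, hZY⟩

theorem _root_.CStarK.IdemMat.zero_sum_one_rel {R : Type*} [Ring R] (m n : ℕ) :
    ((⟨m, 0, by simp⟩ : IdemMat R).sum (IdemMat.one R n)).Rel (IdemMat.one R n) :=
  (IdemMat.Rel.sum (e' := IdemMat.zero R) ⟨0, 0, Matrix.zero_mul _, Matrix.zero_mul _⟩
    ⟨1, 1, mul_one 1, mul_one 1⟩).trans (IdemMat.zero_sum _)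

/-- An idempotent over `A` that becomes trivial over `B` comes from `J`. -/
theorem exists_map_eq_of_map_eq_unit (H : SplitSquare i p s ε ι) {v : V A} {n : ℕ}
    (h : V.map p v = V.unit B n) : ∃ w, V.map i w = v ∧ V.map ε w = V.unit k n := by
  obtain ⟨⟨N, E, hE⟩⟩ := v
  obtain ⟨P, Q, hPQ, hQP⟩ := Quotient.exact h
  change Matrix (Fin N) (Fin n) B at P
  change Matrix (Fin n) (Fin N) B at Q
  change P * Q = E.map p at hPQ
  change Q * P = 1 at hQP
  set E₀ := (E.map p).map s with hE₀
  have hE₀' : E₀ * E₀ = E₀ := by rw [hE₀, ← Matrix.map_mul, ← Matrix.map_mul, hE]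
  have hE₀p : E₀.map p = E.map p := by rw [hE₀, H.map_p_map_s]
  have hbc : P.map s * Q.map s = E₀ := by rw [← Matrix.map_mul, hPQ]
  -- With `E₀ = s(p(E))`, the row `(1 - E₀, s(P))` times the column `(1 - E₀, s(Q))` is `(1 - E₀) +
  -- E₀ = 1`, so `xy = E`. Thus `yx` is an idempotent equivalent to `E`, and its image over `B` is
  -- exactly `0 ⊕ 1`, because `p(1 - E₀)` annihilates `p(E)`.
  let x : Matrix (Fin N) (Fin N ⊕ Fin n) A := E * Matrix.fromCols (1 - E₀) (P.map s)
  let y : Matrix (Fin N ⊕ Fin n) (Fin N) A := Matrix.fromRows (1 - E₀) (Q.map s) * E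
  have hxy : x * y = E := by
    calc x * y = E * (Matrix.fromCols (1 - E₀) (P.map s) * Matrix.fromRows (1 - E₀) (Q.map s))
          * E := by simp only [x, y, Matrix.mul_assoc]
      _ = E := by
        rw [Matrix.fromCols_mul_fromRows, hbc, mul_sub, mul_one, sub_mul, one_mul, hE₀',
          sub_self, sub_zero, sub_add_cancel, mul_one, hE]
  have hsub : (1 - E₀).map p = 1 - E.map p := by
    rw [Matrix.map_sub _ (map_sub p), Matrix.map_one p (map_zero p) (map_one p), hE₀p]
  have hpE : E.map p * E.map p = E.map p := by rw [← Matrix.map_mul, hE]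
  have hzero : (1 - E₀).map p * E.map p = 0 := by
    rw [hsub, sub_mul, one_mul, hpE, sub_self]
  have hzero' : E.map p * (1 - E₀).map p = 0 := by
    rw [hsub, mul_sub, mul_one, hpE, sub_self]
  have hlow : Q * E.map p * (E.map p * P) = 1 := by
    rw [← hPQ]
    calc Q * (P * Q) * (P * Q * P) = (Q * P) * (Q * P) * (Q * P) := by
          simp only [Matrix.mul_assoc]
      _ = 1 := by simp only [hQP, mul_one]
  have hyx : (y * x).map p = Matrix.fromBlocks 0 0 0 1 := by
    have hx : x.map p = Matrix.fromCols 0 (E.map p * P) := by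
      rw [Matrix.map_mul, Matrix.fromCols_map, H.map_p_map_s, Matrix.mul_fromCols, hzero']
    have hy : y.map p = Matrix.fromRows 0 (Q * E.map p) := by
      rw [Matrix.map_mul, Matrix.fromRows_map, H.map_p_map_s, Matrix.fromRows_mul, hzero]
    rw [Matrix.map_mul, hx, hy, Matrix.fromRows_mul_fromCols, hlow]
    simp
  let σ := (finSumFinEquiv : Fin N ⊕ Fin n ≃ Fin (N + n))
  obtain ⟨Y, hY, hYε⟩ := H.lift_matrix ((y * x).submatrix σ.symm σ.symm)
    (((⟨N, 0, by simp⟩ : IdemMat k).sum (IdemMat.one k n)).mat) (by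
      change ((y * x).map p).submatrix σ.symm σ.symm =
        ((((Matrix.fromBlocks 0 0 0 1).map ι).map i).map p).submatrix σ.symm σ.symm
      rw [hyx]
      simp [Matrix.fromBlocks_map])
  have hyxyx : y * x * (y * x) = y * x := by
    calc y * x * (y * x) = y * (x * y) * x := by simp only [Matrix.mul_assoc]
      _ = y * x := by rw [hxy]; simp only [x, ← Matrix.mul_assoc]; rw [Matrix.mul_assoc y, hE]
  have hidem : Y * Y = Y := H.matrix_injective (by
    rw [Matrix.map_mul, hY, Matrix.submatrix_mul_equiv, hyxyx])
  refine ⟨Quotient.mk _ ⟨N + n, Y, hidem⟩, Quotient.sound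
    ⟨y.submatrix σ.symm id, x.submatrix id σ.symm, ?_, ?_⟩, Quotient.sound ?_⟩
  · exact (Matrix.submatrix_mul _ _ _ id _ Function.bijective_id).symm.trans hY.symm
  · exact (Matrix.submatrix_mul_equiv _ _ _ _ _).trans hxy
  · have hrel : (IdemMat.map ε ⟨N + n, Y, hidem⟩).Rel
        ((⟨N, 0, by simp⟩ : IdemMat k).sum (IdemMat.one k n)) :=
      IdemMat.rel_of_submatrix (Equiv.refl _) hYε.symm
    exact hrel.trans (IdemMat.zero_sum_one_rel N n)

/-- After stabilization the first idempotent becomes free over `A`, so its class over `J` comes from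
the scalars; being killed by `ε`, the difference vanishes. -/
theorem K0_injective (H : SplitSquare i p s ε ι) {x : K0Unital J}
    (hε : K0Unital.map ε x = 0) (hx : K0Unital.map i x = 0) : x = 0 := by
  obtain ⟨v, n, rfl⟩ := K0Unital.exists_of_sub_unit x
  rw [map_sub, K0Unital.map_of, K0Unital.map_of, V.map_unit, sub_eq_zero] at hx
  obtain ⟨m, hm⟩ := K0Unital.of_eq_of hx
  have h1 : V.map i (v + V.unit J m) = V.unit A (n + m) := by
    rw [map_add, V.map_unit, hm, V.unit_add]
  have h2 := H.eq_map_of_map_eq_unit h1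
  have h3 : K0Unital.of v - K0Unital.of (V.unit J n) =
      K0Unital.of (v + V.unit J m) - K0Unital.of (V.unit J (n + m)) := by
    rw [← V.unit_add, map_add, map_add]
    abel
  rw [h3] at hε ⊢
  have h4 : K0Unital.of (v + V.unit J m) - K0Unital.of (V.unit J (n + m)) =
      K0Unital.map ι (K0Unital.map ε
        (K0Unital.of (v + V.unit J m) - K0Unital.of (V.unit J (n + m)))) := by
    simp only [map_sub, K0Unital.map_of]
    rw [← h2, V.map_unit, V.map_unit]
  rw [h4, hε, map_zero]

/-- After stabilization the first idempotent becomes free over `B`, so it lifts to `J` with free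
scalar part, and the lifted difference lies in the kernel of `ε`. -/
theorem K0_exact (H : SplitSquare i p s ε ι) {x : K0Unital A} (hx : K0Unital.map p x = 0) :
    ∃ y, K0Unital.map i y = x ∧ K0Unital.map ε y = 0 := by
  obtain ⟨v, n, rfl⟩ := K0Unital.exists_of_sub_unit x
  rw [map_sub, K0Unital.map_of, K0Unital.map_of, V.map_unit, sub_eq_zero] at hx
  obtain ⟨m, hm⟩ := K0Unital.of_eq_of hx
  obtain ⟨w, hw, hwε⟩ := H.exists_map_eq_of_map_eq_unit (v := v + V.unit A m) (n := n + m) (by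
    rw [map_add, V.map_unit, hm, V.unit_add])
  refine ⟨K0Unital.of w - K0Unital.of (V.unit J (n + m)), ?_, ?_⟩
  · rw [map_sub, K0Unital.map_of, K0Unital.map_of, hw, V.map_unit, ← V.unit_add, map_add, map_add]
    abel
  · rw [map_sub, K0Unital.map_of, K0Unital.map_of, hwε, V.map_unit, sub_self]

end SplitSquare

/-! ### Homomorphisms of C⋆-algebras -/

section StarHom

variable {A B : Type*} [NonUnitalCStarAlgebra A] [NonUnitalCStarAlgebra B]

/-- The unital ring homomorphism `A⁺ → B⁺` induced by a homomorphism of C⋆-algebras `A → B`. -/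
noncomputable def plus (f : A →⋆ₙₐ[ℂ] B) : Unitization ℂ A →+* Unitization ℂ B :=
  (Unitization.starMap f : Unitization ℂ A →⋆ₐ[ℂ] Unitization ℂ B).toAlgHom.toRingHom

@[simp] theorem plus_fst (f : A →⋆ₙₐ[ℂ] B) (x : Unitization ℂ A) : (plus f x).fst = x.fst := by
  induction x with
  | inl_add_inr r a =>
    simp [plus, Unitization.algebraMap_eq_inl]

@[simp] theorem plus_snd (f : A →⋆ₙₐ[ℂ] B) (x : Unitization ℂ A) :
    (plus f x).snd = f x.snd := by
  induction x with
  | inl_add_inr r a =>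
    simp [plus, Unitization.algebraMap_eq_inl]

theorem aug_apply (x : Unitization ℂ A) : aug A x = x.fst := rfl

theorem aug_comp_plus (f : A →⋆ₙₐ[ℂ] B) : (aug B).comp (plus f) = aug A :=
  RingHom.ext fun x => plus_fst f x

theorem plus_injective {f : A →⋆ₙₐ[ℂ] B} (hf : Function.Injective f) :
    Function.Injective (plus f) :=
  Unitization.starMap_injective hf

theorem continuous_plus (f : A →⋆ₙₐ[ℂ] B) : Continuous (plus f) :=
  (NonUnitalStarAlgHom.instContinuousLinearMapClassComplex
    (F := Unitization ℂ A →⋆ₐ[ℂ] Unitization ℂ B)).map_continuous (Unitization.starMap f)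

/-- An injective homomorphism of C⋆-algebras is isometric. This is what allows continuity of maps
into `GLₙ(J)` to be tested in `GLₙ(A)`. -/
theorem isInducing_plus {f : A →⋆ₙₐ[ℂ] B} (hf : Function.Injective f) :
    Topology.IsInducing (plus f) :=
  (NonUnitalStarAlgHom.isometry (F := Unitization ℂ A →⋆ₐ[ℂ] Unitization ℂ B)
    (Unitization.starMap f) (plus_injective hf)).isUniformInducing.isInducing

/-- The homomorphism `K₀(A) → K₀(B)` induced by a homomorphism of C⋆-algebras. -/
noncomputable def K0.map (f : A →⋆ₙₐ[ℂ] B) : K0 A →+ K0 B :=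
  ((K0Unital.map (plus f)).comp (K0Unital.map (aug A)).ker.subtype).codRestrict (K0Unital.map (aug B)).ker (by
    rintro ⟨x, hx⟩
    rw [AddMonoidHom.mem_ker] at hx
    change K0Unital.map (aug B) (K0Unital.map (plus f) x) = 0
    rwa [K0Unital.map_map, aug_comp_plus])

end StarHom

/-! ### Split exact sequences of C⋆-algebras and their `K₀` -/

/-- A split short exact sequence `0 → J → A → B → 0` of C⋆-algebras. -/
structure SplitExact {J A B : Type*} [NonUnitalCStarAlgebra J] [NonUnitalCStarAlgebra A]
    [NonUnitalCStarAlgebra B] (i : J →⋆ₙₐ[ℂ] A) (p : A →⋆ₙₐ[ℂ] B) (s : B →⋆ₙₐ[ℂ] A) : Prop where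
  injective : Function.Injective i
  p_s : ∀ b, p (s b) = b
  p_i : ∀ j, p (i j) = 0
  exact : ∀ a, p a = 0 → ∃ j, i j = a

namespace SplitExact

variable {J A B : Type*} [NonUnitalCStarAlgebra J] [NonUnitalCStarAlgebra A]
    [NonUnitalCStarAlgebra B] {i : J →⋆ₙₐ[ℂ] A} {p : A →⋆ₙₐ[ℂ] B} {s : B →⋆ₙₐ[ℂ] A}

/-- The key property is `lift`: an element of `A⁺` whose image in `B⁺` is scalar has its
`A`-component in the kernel of `p`, hence in `J`. -/
theorem splitSquare (H : SplitExact i p s) :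
    SplitSquare (plus i) (plus p) (plus s) (aug J) (Unitization.inlRingHom ℂ J) where
  injective := plus_injective H.injective
  p_s b := Unitization.ext (by simp) (by simp [H.p_s])
  ε_ι c := rfl
  s_p c := Unitization.ext (by simp) (by simp)
  p_i j := Unitization.ext (by simp [aug_apply]) (by simp [H.p_i])
  lift a c h := by
    have h₁ : a.fst = c := by simpa using congrArg (fun x : Unitization ℂ B => x.fst) h
    have h₂ : p a.snd = 0 := by simpa using congrArg (fun x : Unitization ℂ B => x.snd) h
    obtain ⟨j, hj⟩ := H.exact _ h₂
    refine ⟨Unitization.inl c + (j : Unitization ℂ J), Unitization.ext ?_ ?_, ?_⟩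
    · simp [h₁]
    · simp [hj]
    · simp [aug_apply]

theorem plus_p_plus_s (H : SplitExact i p s) :
    (plus p).comp (plus s) = RingHom.id _ :=
  RingHom.ext H.splitSquare.p_s

theorem nonempty_K0_addEquiv (H : SplitExact i p s) : Nonempty (K0 A ≃+ K0 B × K0 J) := by
  refine AddMonoidHom.nonempty_addEquiv_prod_of_split (K0.map i) (K0.map p) (K0.map s)
    (fun _ _ => AddCommute.all _ _) ?_ ?_ ?_ ?_
  · rintro ⟨x, hx⟩
    refine Subtype.ext ?_
    change K0Unital.map (plus p) (K0Unital.map (plus s) x) = x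
    rw [K0Unital.map_map, H.plus_p_plus_s, K0Unital.map_id]
  · rintro ⟨x, hx⟩
    refine Subtype.ext ?_
    have hpi : (plus p).comp (plus i) = (Unitization.inlRingHom ℂ B).comp (aug J) :=
      RingHom.ext fun j => Unitization.ext (by simp [aug_apply]) (by simp [H.p_i])
    change K0Unital.map (plus p) (K0Unital.map (plus i) x) = 0
    rw [K0Unital.map_map, hpi, ← K0Unital.map_map, AddMonoidHom.mem_ker.1 hx, map_zero]
  · rintro ⟨x, hx⟩ h
    exact Subtype.ext (H.splitSquare.K0_injective hx (congrArg Subtype.val h))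
  · rintro ⟨x, hx⟩ h
    obtain ⟨y, hy, hyε⟩ := H.splitSquare.K0_exact (congrArg Subtype.val h)
    exact ⟨⟨y, hyε⟩, Subtype.ext hy⟩

end SplitExact

end CStarK

namespace CStarK

/-! ### Split exactness of `K₁` -/

section StarHom

variable {A B : Type*} [NonUnitalCStarAlgebra A] [NonUnitalCStarAlgebra B]

theorem GLn.ext {n : ℕ} {u v : GLn n A} (h : u.val.val = v.val.val) : u = v :=
  Subtype.ext (Units.ext h)

theorem GLn.map_aug {n : ℕ} (u : GLn n A) : u.val.val.map (aug A) = 1 :=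
  congrArg Units.val u.2

theorem GLn.mem_of_map_aug {n : ℕ} {u : (Matrix (Fin n) (Fin n) (Unitization ℂ A))ˣ}
    (h : u.val.map (aug A) = 1) : u ∈ GLn n A :=
  Units.ext h

/-- The homomorphism `GLₙ(A) → GLₙ(B)` induced by a homomorphism of C⋆-algebras. -/
noncomputable def GLn.map (f : A →⋆ₙₐ[ℂ] B) (n : ℕ) : GLn n A →* GLn n B :=
  ((Units.map ((plus f).mapMatrix (m := Fin n)).toMonoidHom).comp (GLn n A).subtype).codRestrict
    (GLn n B) (by
      intro u
      refine GLn.mem_of_map_aug ?_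
      change (u.val.val.map (plus f)).map (aug B) = 1
      rw [Matrix.map_map, ← RingHom.coe_comp, aug_comp_plus, GLn.map_aug])

theorem GLn.map_val (f : A →⋆ₙₐ[ℂ] B) {n : ℕ} (u : GLn n A) :
    (GLn.map f n u).val.val = u.val.val.map (plus f) := rfl

theorem GLn.continuous_map (f : A →⋆ₙₐ[ℂ] B) (n : ℕ) : Continuous (GLn.map f n) := by
  have h : Continuous (Units.map ((plus f).mapMatrix (m := Fin n)).toMonoidHom) :=
    Continuous.units_map _ (continuous_id.matrix_map (continuous_plus f))
  exact (h.comp continuous_subtype_val).subtype_mk _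

theorem GLn.isInducing_map {f : A →⋆ₙₐ[ℂ] B} (hf : Function.Injective f) (n : ℕ) :
    Topology.IsInducing (GLn.map f n) := by
  have h : Topology.IsInducing
      (Units.map ((plus f).mapMatrix (m := Fin n)).toMonoidHom) :=
    Topology.IsInducing.units_map (isInducing_plus hf).matrix_map
  exact (Topology.IsInducing.subtypeVal.of_comp_iff).1 (h.comp Topology.IsInducing.subtypeVal)

theorem GLn.map_injective {f : A →⋆ₙₐ[ℂ] B} (hf : Function.Injective f) (n : ℕ) :
    Function.Injective (GLn.map f n) := fun _ _ h =>
  GLn.ext (Matrix.map_injective (plus_injective hf) (congrArg (fun w => w.val.val) h))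

theorem GLn.map_pad (f : A →⋆ₙₐ[ℂ] B) {n N : ℕ} (h : n ≤ N) (u : GLn n A) :
    GLn.map f N (GLn.pad h A u) = GLn.pad h B (GLn.map f n u) :=
  GLn.ext (pad_map (plus f) h u.val.val)

theorem GLn.map_mem_GLnZero (f : A →⋆ₙₐ[ℂ] B) {n : ℕ} {u : GLn n A} (hu : u ∈ GLnZero n A) :
    GLn.map f n u ∈ GLnZero n B := by
  have := (GLn.continuous_map f n).image_connectedComponent_subset 1 ⟨u, hu, rfl⟩
  rwa [map_one] at this

/-- The homomorphism `GLₙ(A) / GLₙ(A)₀ → GLₙ(B) / GLₙ(B)₀` induced by a homomorphism of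
C⋆-algebras. -/
noncomputable def GLnQuot.mapHom (f : A →⋆ₙₐ[ℂ] B) (n : ℕ) : GLnQuot A n →* GLnQuot B n :=
  QuotientGroup.map _ _ (GLn.map f n) fun _ hu => GLn.map_mem_GLnZero f hu

variable (A) in
/-- The group `K₁(A)`, written multiplicatively. -/
abbrev K1Mul : Type _ := DirectLimit (GLnQuot A) (GLnQuot.map A)

/-- The class in `K₁(A)` of an invertible matrix. -/
noncomputable def K1Mul.mk {n : ℕ} (u : GLn n A) : K1Mul A :=
  Quotient.mk _ ⟨n, QuotientGroup.mk u⟩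

theorem K1Mul.mk_mul {n : ℕ} (u v : GLn n A) : mk (u * v) = mk u * mk v := by
  have h (x y : GLnQuot A n) := DirectLimit.mul_def (f := GLnQuot.map A) n x y
  exact (h (QuotientGroup.mk u) (QuotientGroup.mk v)).symm

theorem K1Mul.mk_pad {n N : ℕ} (h : n ≤ N) (u : GLn n A) : mk (GLn.pad h A u) = mk u := by
  have h' (x : GLnQuot A n) := DirectLimit.mk_apply (f := GLnQuot.map A) n N x h
  exact h' (QuotientGroup.mk u)

theorem K1Mul.exists_mk (x : K1Mul A) : ∃ n, ∃ u : GLn n A, x = mk u := by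
  obtain ⟨n, ⟨u⟩, rfl⟩ := DirectLimit.exists_eq_mk (GLnQuot.map A) x
  exact ⟨n, u, rfl⟩

theorem K1Mul.mk_eq_one {n : ℕ} {u : GLn n A} :
    mk u = 1 ↔ ∃ N, ∃ h : n ≤ N, GLn.pad h A u ∈ GLnZero N A := by
  refine (DirectLimit.exists_eq_one _).trans (exists_congr fun N => exists_congr fun h => ?_)
  exact QuotientGroup.eq_one_iff (GLn.pad h A u)

theorem K1Mul.mk_eq_one_of_mem {n : ℕ} {u : GLn n A} (h : u ∈ GLnZero n A) : mk u = 1 := by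
  refine mk_eq_one.2 ⟨n, le_rfl, ?_⟩
  have : GLn.pad le_rfl A u = u := GLn.ext (pad_self _)
  rwa [this]

/-- The homomorphism `K₁(A) → K₁(B)` induced by a homomorphism of C⋆-algebras. -/
noncomputable def K1Mul.map (f : A →⋆ₙₐ[ℂ] B) : K1Mul A →* K1Mul B :=
  MonoidHom.mk' (DirectLimit.map (GLnQuot.map A) (GLnQuot.map B) (fun n => GLnQuot.mapHom f n) (by
      rintro n N h ⟨u⟩
      exact congrArg QuotientGroup.mk (GLn.map_pad f h u).symm)) (by
    refine DirectLimit.induction₂ _ ?_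
    rintro n x y
    rw [DirectLimit.mul_def, DirectLimit.map_def, DirectLimit.map_def, DirectLimit.map_def,
      DirectLimit.mul_def, map_mul])

theorem K1Mul.map_mk (f : A →⋆ₙₐ[ℂ] B) {n : ℕ} (u : GLn n A) :
    map f (mk u) = mk (GLn.map f n u) := rfl

/-! ### Commutativity of `K₁` -/

theorem mem_GLnZero_of_continuous {n : ℕ} (w : ℝ → GLn n A) (hw : Continuous w) (h₀ : w 0 = 1)
    (t : ℝ) : w t ∈ GLnZero n A := by
  have := (isPreconnected_range hw).subset_connectedComponent (x := w 0) ⟨0, rfl⟩ ⟨t, rfl⟩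
  rwa [h₀] at this

/-- The block matrix `[[a, -b], [b, a]]` of scalar matrices. -/
noncomputable def rotMat (R : Type*) [Ring R] [Algebra ℝ R] (n : ℕ) (a b : ℝ) :
    Matrix (Fin (n + n)) (Fin (n + n)) R :=
  Matrix.reindex finSumFinEquiv finSumFinEquiv (Matrix.fromBlocks (a • 1) (-(b • 1)) (b • 1) (a • 1))

theorem rotMat_mul {R : Type*} [Ring R] [Algebra ℝ R] (n : ℕ) {a b : ℝ} (h : a * a + b * b = 1) :
    rotMat R n a b * rotMat R n a (-b) = 1 := by
  have h' : b * b + a * a = 1 := by rw [add_comm, h]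
  simp only [rotMat, Matrix.reindex_apply, Matrix.submatrix_mul_equiv, Matrix.fromBlocks_multiply]
  simp [← mul_smul, ← add_smul, h, h', mul_comm a b]

theorem continuous_rotMat {R : Type*} [Ring R] [Algebra ℝ R] [TopologicalSpace R]
    [IsTopologicalRing R] [ContinuousSMul ℝ R] (n : ℕ) :
    Continuous fun x : ℝ × ℝ => rotMat R n x.1 x.2 := by
  refine Continuous.matrix_reindex ?_ _ _
  refine Continuous.matrix_fromBlocks ?_ ?_ ?_ ?_ <;> fun_prop

/-- The rotation by the angle `t`, as an invertible block matrix. -/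
noncomputable def rot (R : Type*) [Ring R] [Algebra ℝ R] (n : ℕ) (t : ℝ) :
    (Matrix (Fin (n + n)) (Fin (n + n)) R)ˣ where
  val := rotMat R n (Real.cos t) (Real.sin t)
  inv := rotMat R n (Real.cos t) (-Real.sin t)
  val_inv := rotMat_mul n (by nlinarith [Real.sin_sq_add_cos_sq t])
  inv_val := by
    have := rotMat_mul (R := R) n (a := Real.cos t) (b := -Real.sin t)
      (by nlinarith [Real.sin_sq_add_cos_sq t])
    rwa [neg_neg] at this

theorem rot_zero {R : Type*} [Ring R] [Algebra ℝ R] (n : ℕ) : rot R n 0 = 1 := by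
  refine Units.ext ?_
  simp [rot, rotMat]

theorem continuous_rot {R : Type*} [Ring R] [Algebra ℝ R] [TopologicalSpace R]
    [IsTopologicalRing R] [ContinuousSMul ℝ R] (n : ℕ) : Continuous (rot R n) := by
  refine Units.continuous_iff.2 ⟨?_, ?_⟩
  · exact (continuous_rotMat n).comp (Real.continuous_cos.prodMk Real.continuous_sin)
  · exact (continuous_rotMat n).comp (Real.continuous_cos.prodMk Real.continuous_sin.neg)

/-- At angle `π / 2` the rotation is `[[0, -1], [1, 0]]`, which interchanges the two blocks. -/
theorem rot_conj {R : Type*} [Ring R] [Algebra ℝ R] {n : ℕ} (u : Matrix (Fin n) (Fin n) R) :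
    (rot R n (Real.pi / 2)).val * blockSum u 1 = blockSum 1 u * (rot R n (Real.pi / 2)).val := by
  simp [rot, rotMat, blockSum, Matrix.submatrix_mul_equiv, Matrix.fromBlocks_multiply]

/-- The matrix `1 ⊕ u`, for `u` in `GLₙ(A)`. -/
noncomputable def GLn.lowerPad {n : ℕ} (u : GLn n A) : GLn (n + n) A :=
  ⟨rot _ n (Real.pi / 2) * (GLn.pad (Nat.le_add_right n n) A u).val * (rot _ n (Real.pi / 2))⁻¹,
    Subgroup.Normal.conj_mem inferInstance _ (GLn.pad (Nat.le_add_right n n) A u).2 _⟩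

theorem GLn.lowerPad_val {n : ℕ} (u : GLn n A) :
    (GLn.lowerPad u).val.val = blockSum 1 u.val.val := by
  have h : (GLn.pad (Nat.le_add_right n n) A u).val.val = blockSum u.val.val 1 :=
    padMat_eq_blockSum (Nat.le_add_right n n) _
  change (rot _ n (Real.pi / 2)).val * (GLn.pad (Nat.le_add_right n n) A u).val.val *
    ((rot _ n (Real.pi / 2))⁻¹).val = _
  rw [h, rot_conj, mul_assoc, ← Units.val_mul, mul_inv_cancel, Units.val_one, mul_one]

/-- Conjugating `u ⊕ 1` by rotations of angle from `0` to `π / 2` gives a path to `1 ⊕ u`. The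
rotations are scalar matrices, generally not congruent to `1` modulo `A`, but their conjugates of `u
⊕ 1` stay in `GLₙ(A)`, a kernel and so normal. -/
theorem K1Mul.mk_lowerPad {n : ℕ} (u : GLn n A) : mk (GLn.lowerPad u) = mk u := by
  set U := GLn.pad (Nat.le_add_right n n) A u with hU
  let w : ℝ → GLn (n + n) A := fun t => ⟨rot _ n t * U.val * (rot _ n t)⁻¹,
    Subgroup.Normal.conj_mem inferInstance _ U.2 _⟩
  have hw : Continuous w := by
    refine Continuous.subtype_mk ?_ _
    have := continuous_rot (R := Unitization ℂ A) n
    exact (this.mul continuous_const).mul this.inv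
  have h : w (Real.pi / 2) * U⁻¹ ∈ GLnZero (n + n) A := by
    refine mem_GLnZero_of_continuous (fun t => w t * U⁻¹) (hw.mul continuous_const) ?_ _
    have : w 0 = U := Subtype.ext (by simp [w, rot_zero])
    rw [this, mul_inv_cancel]
  have h' := mk_eq_one_of_mem h
  have h'' : w (Real.pi / 2) * U⁻¹ * U = GLn.lowerPad u := by
    rw [inv_mul_cancel_right]
    rfl
  rw [← h'', mk_mul, h', one_mul, hU, mk_pad]

/-- Represent one class by `1 ⊕ u` and the other by `v ⊕ 1`; these matrices commute. -/
theorem K1Mul.mul_comm (x y : K1Mul A) : x * y = y * x := by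
  obtain ⟨n, x, y, rfl, rfl⟩ := DirectLimit.exists_eq_mk₂ (GLnQuot.map A) x y
  obtain ⟨u, rfl⟩ := QuotientGroup.mk_surjective x
  obtain ⟨v, rfl⟩ := QuotientGroup.mk_surjective y
  change mk u * mk v = mk v * mk u
  rw [← mk_lowerPad u, ← mk_pad (Nat.le_add_right n n) v, ← mk_mul, ← mk_mul]
  congr 1
  refine GLn.ext ?_
  have h : (GLn.pad (Nat.le_add_right n n) A v).val.val = blockSum v.val.val 1 :=
    padMat_eq_blockSum (Nat.le_add_right n n) _
  change (GLn.lowerPad u).val.val * (GLn.pad (Nat.le_add_right n n) A v).val.val =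
    (GLn.pad (Nat.le_add_right n n) A v).val.val * (GLn.lowerPad u).val.val
  rw [h, GLn.lowerPad_val, blockSum_mul, blockSum_mul, one_mul, mul_one, one_mul, mul_one]

end StarHom

/-! ### The split exact sequence on `GLₙ` and on `K₁` -/

namespace SplitExact

variable {J A B : Type*} [NonUnitalCStarAlgebra J] [NonUnitalCStarAlgebra A]
    [NonUnitalCStarAlgebra B] {i : J →⋆ₙₐ[ℂ] A} {p : A →⋆ₙₐ[ℂ] B} {s : B →⋆ₙₐ[ℂ] A}

theorem GLn_p_s (H : SplitExact i p s) {n : ℕ} (u : GLn n B) :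
    GLn.map p n (GLn.map s n u) = u :=
  GLn.ext (H.splitSquare.map_p_map_s _)

theorem GLn_p_i (H : SplitExact i p s) {n : ℕ} (u : GLn n J) :
    GLn.map p n (GLn.map i n u) = 1 := by
  refine GLn.ext ?_
  rw [GLn.map_val, GLn.map_val, H.splitSquare.map_p_map_i, GLn.map_aug]
  simp only [Matrix.map_one _ (map_zero _) (map_one _)]
  rfl

/-- Both `a` and `a⁻¹` lift to matrices over `J⁺`, and injectivity of `i` makes the lifts inverse to
each other. -/
theorem GLn_exact (H : SplitExact i p s) {n : ℕ} {a : GLn n A} (ha : GLn.map p n a = 1) :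
    ∃ u, GLn.map i n u = a := by
  have key : ∀ a : GLn n A, GLn.map p n a = 1 → ∃ Y : Matrix (Fin n) (Fin n) (Unitization ℂ J),
      Y.map (plus i) = a.val.val ∧ Y.map (aug J) = 1 := fun a ha =>
    H.splitSquare.lift_matrix _ _ (by
      simp only [Matrix.map_one _ (map_zero _) (map_one _)]
      exact congrArg (fun w => w.val.val) ha)
  obtain ⟨Y, hY, hYa⟩ := key a ha
  obtain ⟨Z, hZ, -⟩ := key a⁻¹ (by rw [map_inv, ha, inv_one])
  have hone : (1 : Matrix (Fin n) (Fin n) (Unitization ℂ J)).map (plus i) = 1 :=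
    Matrix.map_one _ (map_zero _) (map_one _)
  refine ⟨⟨⟨Y, Z, H.splitSquare.matrix_injective ?_, H.splitSquare.matrix_injective ?_⟩,
    GLn.mem_of_map_aug hYa⟩, GLn.ext hY⟩
  · rw [Matrix.map_mul, hY, hZ, hone]
    exact congrArg (fun w : GLn n A => w.val.val) (mul_inv_cancel a)
  · rw [Matrix.map_mul, hY, hZ, hone]
    exact congrArg (fun w : GLn n A => w.val.val) (inv_mul_cancel a)

/-- The map `r` given by `a ↦ a · s(p(a))⁻¹` takes values in `GLₙ(J)`, is continuous because
`GLn.map i n` is inducing, and is a left inverse of `GLn.map i n` fixing `1`. It therefore carries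
the identity component of `GLₙ(A)` into that of `GLₙ(J)`. -/
theorem mem_GLnZero_of_map_mem (H : SplitExact i p s) {n : ℕ} {u : GLn n J}
    (hu : GLn.map i n u ∈ GLnZero n A) : u ∈ GLnZero n J := by
  have hr : ∀ a : GLn n A, ∃ v : GLn n J,
      GLn.map i n v = a * (GLn.map s n (GLn.map p n a))⁻¹ := fun a =>
    H.GLn_exact (by rw [map_mul, map_inv, H.GLn_p_s, mul_inv_cancel])
  choose r hr using hr
  have hrc : Continuous r := by
    rw [(GLn.isInducing_map H.injective n).continuous_iff]
    have h₁ := GLn.continuous_map p n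
    have h₂ := GLn.continuous_map s n
    have : GLn.map i n ∘ r = fun a => a * (GLn.map s n (GLn.map p n a))⁻¹ := funext hr
    rw [this]
    fun_prop
  have hr₁ : r 1 = 1 := GLn.map_injective H.injective n (by rw [hr]; simp)
  have hru : r (GLn.map i n u) = u :=
    GLn.map_injective H.injective n (by rw [hr, H.GLn_p_i]; simp)
  have := hrc.image_connectedComponent_subset 1 ⟨_, hu, rfl⟩
  rwa [hr₁, hru] at this

theorem nonempty_K1_addEquiv (H : SplitExact i p s) : Nonempty (K1 A ≃+ K1 B × K1 J) := by
  refine AddMonoidHom.nonempty_addEquiv_prod_of_split (K1Mul.map i).toAdditive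
    (K1Mul.map p).toAdditive (K1Mul.map s).toAdditive
    (fun _ _ => K1Mul.mul_comm _ _) ?_ ?_ ?_ ?_
  · intro b
    obtain ⟨n, u, hu⟩ := K1Mul.exists_mk (Additive.toMul b)
    change K1Mul.map p (K1Mul.map s (Additive.toMul b)) = Additive.toMul b
    rw [hu, K1Mul.map_mk, K1Mul.map_mk, H.GLn_p_s]
  · intro j
    obtain ⟨n, u, hu⟩ := K1Mul.exists_mk (Additive.toMul j)
    change K1Mul.map p (K1Mul.map i (Additive.toMul j)) = 1
    rw [hu, K1Mul.map_mk, K1Mul.map_mk, H.GLn_p_i]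
    exact K1Mul.mk_eq_one_of_mem (one_mem _)
  · intro j hj
    obtain ⟨n, u, hu⟩ := K1Mul.exists_mk (Additive.toMul j)
    change K1Mul.map i (Additive.toMul j) = 1 at hj
    change Additive.toMul j = 1
    rw [hu, K1Mul.map_mk] at hj
    obtain ⟨N, h, hN⟩ := K1Mul.mk_eq_one.1 hj
    rw [← GLn.map_pad] at hN
    rw [hu]
    exact K1Mul.mk_eq_one.2 ⟨N, h, H.mem_GLnZero_of_map_mem hN⟩
  · intro a ha
    obtain ⟨n, u, hu⟩ := K1Mul.exists_mk (Additive.toMul a)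
    change K1Mul.map p (Additive.toMul a) = 1 at ha
    rw [hu, K1Mul.map_mk] at ha
    obtain ⟨N, h, hN⟩ := K1Mul.mk_eq_one.1 ha
    set U := GLn.pad h A u with hU
    rw [← GLn.map_pad] at hN
    obtain ⟨v, hv⟩ := H.GLn_exact (a := U * (GLn.map s N (GLn.map p N U))⁻¹)
      (by rw [map_mul, map_inv, H.GLn_p_s, mul_inv_cancel])
    refine ⟨Additive.ofMul (K1Mul.mk v), ?_⟩
    change K1Mul.map i (K1Mul.mk v) = Additive.toMul a
    -- The correction factor `s(p(U))` lies in the identity component since `p(U)` does, so dividing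
    -- by it leaves the class of `U` unchanged.
    have hs : K1Mul.mk (GLn.map s N (GLn.map p N U)) = 1 :=
      K1Mul.mk_eq_one_of_mem (GLn.map_mem_GLnZero s hN)
    rw [K1Mul.map_mk, hv, hu, ← K1Mul.mk_pad h u, ← mul_one (K1Mul.mk _), ← hs, ← K1Mul.mk_mul,
      inv_mul_cancel_right]

end SplitExact

end CStarK

/-! ### Collapsing a ball -/

/-- The map of a normed space that collapses the closed unit ball to the origin, is radial, and is
the identity outside the ball of radius `2`. -/
noncomputable def radialCollapse {W : Type*} [NormedAddCommGroup W] [NormedSpace ℝ W] (w : W) : W :=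
  min 1 (2 - 2 / max ‖w‖ 1) • w

section RadialCollapse

variable {W : Type*} [NormedAddCommGroup W]

theorem radialCollapse_factor_pos {w : W} (h : 1 < ‖w‖) : 0 < min 1 (2 - 2 / max ‖w‖ 1) := by
  rw [max_eq_left h.le]
  have : 2 / ‖w‖ < 2 := (div_lt_iff₀ (by linarith)).2 (by linarith)
  exact lt_min one_pos (by linarith)

variable [NormedSpace ℝ W]

theorem continuous_radialCollapse : Continuous (radialCollapse : W → W) := by
  unfold radialCollapse
  refine Continuous.smul (continuous_const.min (continuous_const.sub
    (continuous_const.div (continuous_norm.max continuous_const) fun w => ?_))) continuous_id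
  have := le_max_right ‖w‖ 1
  positivity

theorem radialCollapse_of_norm_le_one {w : W} (h : ‖w‖ ≤ 1) : radialCollapse w = 0 := by
  simp [radialCollapse, max_eq_right h]

theorem radialCollapse_of_two_le_norm {w : W} (h : 2 ≤ ‖w‖) : radialCollapse w = w := by
  have h₁ : 2 / ‖w‖ ≤ 1 := (div_le_one (by linarith)).2 h
  rw [radialCollapse, max_eq_left (by linarith), min_eq_left (by linarith), one_smul]

theorem norm_radialCollapse {w : W} (h : 1 < ‖w‖) :
    ‖radialCollapse w‖ = min ‖w‖ (2 * ‖w‖ - 2) := by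
  have h₀ : 0 < ‖w‖ := by linarith
  rw [radialCollapse, norm_smul, Real.norm_of_nonneg (radialCollapse_factor_pos h).le,
    max_eq_left h.le, min_mul_of_nonneg _ _ h₀.le, one_mul, sub_mul, div_mul_cancel₀ _ h₀.ne']

theorem radialCollapse_eq_zero {w : W} (h : radialCollapse w = 0) : ‖w‖ ≤ 1 := by
  by_contra! hw
  have h' := norm_radialCollapse hw
  rw [h, norm_zero] at h'
  rcases min_cases ‖w‖ (2 * ‖w‖ - 2) with ⟨h₁, _⟩ | ⟨h₁, _⟩ <;> linarith

theorem radialCollapse_eq_iff {v w : W} :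
    radialCollapse v = radialCollapse w ↔ v = w ∨ (‖v‖ ≤ 1 ∧ ‖w‖ ≤ 1) := by
  constructor
  · intro h
    rcases le_or_gt ‖v‖ 1 with hv | hv
    · rw [radialCollapse_of_norm_le_one hv] at h
      exact Or.inr ⟨hv, radialCollapse_eq_zero h.symm⟩
    rcases le_or_gt ‖w‖ 1 with hw | hw
    · rw [radialCollapse_of_norm_le_one hw] at h
      exact Or.inr ⟨radialCollapse_eq_zero h, hw⟩
    have hn : ‖v‖ = ‖w‖ := by
      have h' := congrArg norm h
      rw [norm_radialCollapse hv, norm_radialCollapse hw] at h'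
      rcases min_cases ‖v‖ (2 * ‖v‖ - 2) with ⟨h₁, _⟩ | ⟨h₁, _⟩ <;>
      rcases min_cases ‖w‖ (2 * ‖w‖ - 2) with ⟨h₂, _⟩ | ⟨h₂, _⟩ <;> linarith
    rw [radialCollapse, radialCollapse, hn] at h
    exact Or.inl (smul_right_injective W (radialCollapse_factor_pos hw).ne' h)
  · rintro (rfl | ⟨hv, hw⟩)
    · rfl
    · rw [radialCollapse_of_norm_le_one hv, radialCollapse_of_norm_le_one hw]

theorem radialCollapse_surjective : Function.Surjective (radialCollapse : W → W) := by
  intro w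
  rcases le_or_gt 2 ‖w‖ with hw | hw
  · exact ⟨w, radialCollapse_of_two_le_norm hw⟩
  by_cases h₀ : w = 0
  · exact ⟨0, by rw [h₀, radialCollapse_of_norm_le_one (by simp)]⟩
  have hpos : 0 < ‖w‖ := norm_pos_iff.2 h₀
  -- Between radii `1` and `2` the radius `r` goes to `2r - 2`; solving `2r - 2 = ‖w‖` gives `r =
  -- (‖w‖ + 2) / 2`.
  have hn : ‖((‖w‖ + 2) / (2 * ‖w‖)) • w‖ = (‖w‖ + 2) / 2 := by
    rw [norm_smul, Real.norm_of_nonneg (by positivity)]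
    field_simp
  refine ⟨((‖w‖ + 2) / (2 * ‖w‖)) • w, ?_⟩
  have h₁ : 2 - 2 / ((‖w‖ + 2) / 2) ≤ 1 := by
    have : 1 ≤ 2 / ((‖w‖ + 2) / 2) := (one_le_div (by linarith)).2 (by linarith)
    linarith
  rw [radialCollapse, hn, max_eq_left (by linarith), min_eq_right h₁, smul_smul]
  convert one_smul ℝ w using 2
  field_simp
  ring

end RadialCollapse

/-- A continuous surjection of `M` onto itself, supported in a coordinate chart, that collapses the
closed unit ball of the chart to a point and is injective otherwise. -/
theorem exists_collapse_ball {M W : Type*} [TopologicalSpace M] [T2Space M]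
    [NormedAddCommGroup W] [NormedSpace ℝ W] [ProperSpace W] {U : Set M} (hU : IsOpen U)
    (ψ : U ≃ₜ W) :
    ∃ (Φ : M → M) (K : Set M), Continuous Φ ∧ Function.Surjective Φ ∧ IsCompact K ∧
      (∀ x ∉ K, Φ x = x) ∧ ∀ x y, Φ x = Φ y ↔ x = y ∨
        (x ∈ Subtype.val '' (ψ ⁻¹' Metric.closedBall 0 1) ∧
          y ∈ Subtype.val '' (ψ ⁻¹' Metric.closedBall 0 1)) := by
  classical
  let Φ : M → M := fun x => if h : x ∈ U then ψ.symm (radialCollapse (ψ ⟨x, h⟩)) else x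
  have hΦ : ∀ x : U, Φ x = ψ.symm (radialCollapse (ψ x)) := fun x => dif_pos x.2
  have hΦ' : ∀ x ∉ U, Φ x = x := fun x h => dif_neg h
  have hΦU : ∀ x, Φ x ∈ U ↔ x ∈ U := fun x => by
    by_cases h : x ∈ U
    · exact ⟨fun _ => h, fun _ => by rw [hΦ ⟨x, h⟩]; exact Subtype.coe_prop _⟩
    · rw [hΦ' x h]
  let K : Set M := (fun w => (ψ.symm w : M)) '' Metric.closedBall 0 2
  have hK : IsCompact K := (isCompact_closedBall 0 2).image
    (continuous_subtype_val.comp ψ.symm.continuous)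
  have hid : ∀ x ∉ K, Φ x = x := by
    intro x hx
    by_cases h : x ∈ U
    · have h2 : 2 ≤ ‖ψ ⟨x, h⟩‖ := by
        by_contra! h2
        exact hx ⟨ψ ⟨x, h⟩, by simpa using h2.le, by simp⟩
      rw [hΦ ⟨x, h⟩, radialCollapse_of_two_le_norm h2, ψ.symm_apply_apply]
    · exact hΦ' x h
  refine ⟨Φ, K, ?_, ?_, hK, hid, ?_⟩
  · rw [continuous_iff_continuousAt]
    intro x
    by_cases h : x ∈ U
    · refine ContinuousOn.continuousAt ?_ (hU.mem_nhds h)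
      rw [continuousOn_iff_continuous_domRestrict]
      have : U.domRestrict Φ = fun x => (ψ.symm (radialCollapse (ψ x)) : M) := funext hΦ
      rw [this]
      exact continuous_subtype_val.comp
        (ψ.symm.continuous.comp (continuous_radialCollapse.comp ψ.continuous))
    -- The compact set `K` lies in `U` and is closed in the Hausdorff space `M`, so `Φ` is the
    -- identity near every point outside `U`.
    · have hxK : x ∉ K := by
        rintro ⟨w, _, rfl⟩
        exact h (Subtype.coe_prop _)
      have : Φ =ᶠ[nhds x] id :=
        Filter.eventuallyEq_of_mem (hK.isClosed.isOpen_compl.mem_nhds hxK) hid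
      exact continuousAt_id.congr this.symm
  · intro y
    by_cases h : y ∈ U
    · obtain ⟨w, hw⟩ := radialCollapse_surjective (ψ ⟨y, h⟩)
      exact ⟨ψ.symm w, by rw [hΦ, ψ.apply_symm_apply, hw, ψ.symm_apply_apply]⟩
    · exact ⟨y, hΦ' y h⟩
  · intro x y
    constructor
    · intro hxy
      by_cases hx : x ∈ U
      · have hy : y ∈ U := by rwa [← hΦU, ← hxy, hΦU]
        rw [hΦ ⟨x, hx⟩, hΦ ⟨y, hy⟩] at hxy
        have h := ψ.symm.injective (Subtype.val_injective hxy)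
        rcases radialCollapse_eq_iff.1 h with h | ⟨h₁, h₂⟩
        · exact Or.inl (congrArg Subtype.val (ψ.injective h))
        · exact Or.inr ⟨⟨⟨x, hx⟩, by simpa using h₁, rfl⟩, ⟨⟨y, hy⟩, by simpa using h₂, rfl⟩⟩
      · have hy : y ∉ U := by rwa [← hΦU, ← hxy, hΦU]
        rw [hΦ' x hx, hΦ' y hy] at hxy
        exact Or.inl hxy
    · rintro (rfl | ⟨⟨x, hx, rfl⟩, ⟨y, hy, rfl⟩⟩)
      · rfl
      · rw [hΦ, hΦ, radialCollapse_eq_iff.2 (Or.inr ⟨by simpa using hx, by simpa using hy⟩)]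

/-! ### The space `X / Y` -/

section Collapse

variable {X : Type*} [TopologicalSpace X] {Y : Set X}

/-- The projection `X → X / Y`. -/
def Collapse.mk (Y : Set X) (x : X) : Collapse Y := Quotient.mk _ x

theorem Collapse.mk_eq_mk {x y : X} :
    Collapse.mk Y x = Collapse.mk Y y ↔ x = y ∨ (x ∈ Y ∧ y ∈ Y) :=
  Quotient.eq

theorem Collapse.isQuotientMap_mk : Topology.IsQuotientMap (Collapse.mk Y) :=
  isQuotientMap_quotient_mk'

/-- The saturation of a closed set `C` is `C ∪ Y` or `C`, according to whether `C` meets `Y`. -/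
theorem Collapse.isClosedMap_mk (hY : IsClosed Y) : IsClosedMap (Collapse.mk Y) := by
  intro C hC
  rw [← isQuotientMap_mk.isClosed_preimage]
  by_cases h : (C ∩ Y).Nonempty
  · convert hC.union hY
    ext x
    constructor
    · rintro ⟨y, hy, hyx⟩
      rcases mk_eq_mk.1 hyx with rfl | ⟨_, h'⟩
      exacts [Or.inl hy, Or.inr h']
    · rintro (hx | hx)
      · exact ⟨x, hx, rfl⟩
      · obtain ⟨y, hy, hyY⟩ := h
        exact ⟨y, hy, mk_eq_mk.2 (Or.inr ⟨hyY, hx⟩)⟩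
  · convert hC
    ext x
    constructor
    · rintro ⟨y, hy, hyx⟩
      rcases mk_eq_mk.1 hyx with rfl | ⟨h', _⟩
      exacts [hy, absurd ⟨y, hy, h'⟩ h]
    · exact fun hx => ⟨x, hx, rfl⟩

theorem Collapse.isProperMap_mk (hY : IsClosed Y) (hYc : IsCompact Y) :
    IsProperMap (Collapse.mk Y) := by
  refine isProperMap_iff_isClosedMap_and_compact_fibers.2
    ⟨isQuotientMap_mk.continuous, isClosedMap_mk hY, fun z => ?_⟩
  obtain ⟨x, rfl⟩ := isQuotientMap_mk.surjective z
  by_cases hx : x ∈ Y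
  · convert hYc
    ext y
    refine mk_eq_mk.trans ⟨?_, fun hy => Or.inr ⟨hy, hx⟩⟩
    rintro (rfl | h)
    exacts [hx, h.1]
  · convert isCompact_singleton (x := x)
    ext y
    refine mk_eq_mk.trans ⟨?_, fun hy => Or.inl hy⟩
    rintro (rfl | h)
    exacts [rfl, absurd h.2 hx]

end Collapse

/-! ### Homomorphisms between algebras of functions vanishing at infinity -/

/-- Pullback along a continuous proper map, as a homomorphism of C⋆-algebras. -/
noncomputable def ZeroAtInftyContinuousMap.pullback {X Z : Type*} [TopologicalSpace X] [TopologicalSpace Z]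
    (g : CocompactMap X Z) : C₀(Z, ℂ) →⋆ₙₐ[ℂ] C₀(X, ℂ) :=
  { ZeroAtInftyContinuousMap.compNonUnitalAlgHom (R := ℂ) g with
    map_star' := fun _ => rfl }

theorem ZeroAtInftyContinuousMap.exists_isCompact_norm_lt {X : Type*} [TopologicalSpace X]
    (h : C₀(X, ℂ)) {ε : ℝ} (hε : 0 < ε) : ∃ K, IsCompact K ∧ ∀ x ∉ K, ‖h x‖ < ε := by
  have := h.zero_at_infty'.eventually (Metric.ball_mem_nhds 0 hε)
  obtain ⟨K, hK, hKh⟩ := Filter.mem_cocompact.1 this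
  exact ⟨K, hK, fun x hx => by simpa using hKh hx⟩

theorem tendsto_cocompact_nhds_zero {X : Type*} [TopologicalSpace X] {f : X → ℂ}
    (h : ∀ ε > 0, ∃ K, IsCompact K ∧ ∀ x ∉ K, ‖f x‖ < ε) :
    Filter.Tendsto f (Filter.cocompact X) (nhds 0) := by
  rw [Metric.tendsto_nhds]
  intro ε hε
  obtain ⟨K, hK, hf⟩ := h ε hε
  exact Filter.mem_of_superset hK.compl_mem_cocompact fun x hx => by simpa using hf x hx

section ExtendByZero

variable {X O : Type*} {j : O → X}

/-- At a point outside the range of `j`, the function is smaller than `ε` off the image of a compact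
set, and that image is closed. -/
theorem continuous_extend_zero [TopologicalSpace X] [T2Space X] [TopologicalSpace O]
    (hj : Topology.IsOpenEmbedding j) (h : C₀(O, ℂ)) :
    Continuous (Function.extend j h 0) := by
  rw [continuous_iff_continuousAt]
  intro x
  by_cases hx : x ∈ Set.range j
  · obtain ⟨z, rfl⟩ := hx
    rw [← hj.continuousAt_iff]
    have : Function.extend j h 0 ∘ j = h := funext fun z => hj.injective.extend_apply _ _ _
    rw [this]
    exact (map_continuous h).continuousAt
  · have h0 : Function.extend j h 0 x = 0 := Function.extend_apply' _ _ _ hx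
    rw [ContinuousAt, h0, Metric.tendsto_nhds]
    intro ε hε
    obtain ⟨K, hK, hKh⟩ := h.exists_isCompact_norm_lt hε
    have hjK : (j '' K)ᶜ ∈ nhds x := (hK.image hj.continuous).isClosed.isOpen_compl.mem_nhds
      fun hx' => hx (Set.image_subset_range _ _ hx')
    refine Filter.mem_of_superset hjK fun y hy => ?_
    by_cases hy' : y ∈ Set.range j
    · obtain ⟨z, rfl⟩ := hy'
      simpa [hj.injective.extend_apply] using hKh z fun hz => hy ⟨z, hz, rfl⟩
    · simpa [Function.extend_apply' _ _ _ hy'] using hε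

variable [TopologicalSpace X] {Y : Set X}

/-- The extension by zero of a function on a subset of `X` disjoint from `Y`, as a function
on `X / Y`. -/
noncomputable def Collapse.extendFun (hjY : Disjoint (Set.range j) Y) (h : O → ℂ) :
    Collapse Y → ℂ :=
  Quotient.lift (Function.extend j h 0) (by
    rintro x y (rfl | ⟨hx, hy⟩)
    · rfl
    · rw [Function.extend_apply' _ _ _ (fun hx' => Set.disjoint_left.1 hjY hx' hx),
        Function.extend_apply' _ _ _ (fun hy' => Set.disjoint_left.1 hjY hy' hy)]
      rfl)

theorem Collapse.extendFun_of_mem (hj : Function.Injective j)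
    (hjY : Disjoint (Set.range j) Y) (h : O → ℂ) (z : O) :
    Collapse.extendFun hjY h (Collapse.mk Y (j z)) = h z :=
  hj.extend_apply _ _ _

theorem Collapse.extendFun_of_notMem
    (hjY : Disjoint (Set.range j) Y) (h : O → ℂ) {x : X} (hx : x ∉ Set.range j) :
    Collapse.extendFun hjY h (Collapse.mk Y x) = 0 :=
  Function.extend_apply' _ _ _ hx

theorem Collapse.funext_extend {f g : Collapse Y → ℂ}
    (h₁ : ∀ z, f (Collapse.mk Y (j z)) = g (Collapse.mk Y (j z)))
    (h₂ : ∀ x ∉ Set.range j, f (Collapse.mk Y x) = g (Collapse.mk Y x)) : f = g := by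
  funext x
  obtain ⟨x, rfl⟩ := Collapse.isQuotientMap_mk.surjective x
  by_cases hx : x ∈ Set.range j
  · obtain ⟨z, rfl⟩ := hx
    exact h₁ z
  · exact h₂ x hx

variable [T2Space X] [TopologicalSpace O]

/-- The extension by zero of a function vanishing at infinity on an open subset of `X` disjoint
from `Y`, as a function vanishing at infinity on `X / Y`. -/
noncomputable def Collapse.extendZero (hj : Topology.IsOpenEmbedding j)
    (hjY : Disjoint (Set.range j) Y) (h : C₀(O, ℂ)) : C₀(Collapse Y, ℂ) where
  toFun := Collapse.extendFun hjY h
  continuous_toFun := (continuous_extend_zero hj h).quotient_lift _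
  zero_at_infty' := tendsto_cocompact_nhds_zero fun ε hε => by
    obtain ⟨K, hK, hKh⟩ := h.exists_isCompact_norm_lt hε
    refine ⟨Collapse.mk Y '' (j '' K),
      (hK.image hj.continuous).image Collapse.isQuotientMap_mk.continuous, fun x hx => ?_⟩
    obtain ⟨x, rfl⟩ := Collapse.isQuotientMap_mk.surjective x
    by_cases hx' : x ∈ Set.range j
    · obtain ⟨z, rfl⟩ := hx'
      rw [Collapse.extendFun_of_mem hj.injective]
      exact hKh z fun hz => hx ⟨_, ⟨z, hz, rfl⟩, rfl⟩
    · rwa [Collapse.extendFun_of_notMem hjY _ hx', norm_zero]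

theorem Collapse.extendZero_apply (hj : Topology.IsOpenEmbedding j)
    (hjY : Disjoint (Set.range j) Y) (h : C₀(O, ℂ)) (x : Collapse Y) :
    Collapse.extendZero hj hjY h x = Collapse.extendFun hjY h x := rfl

/-- Extension by zero, as a homomorphism of C⋆-algebras. -/
noncomputable def Collapse.extend (hj : Topology.IsOpenEmbedding j)
    (hjY : Disjoint (Set.range j) Y) : C₀(O, ℂ) →⋆ₙₐ[ℂ] C₀(Collapse Y, ℂ) where
  toFun := Collapse.extendZero hj hjY
  map_smul' c f := DFunLike.coe_injective <| Collapse.funext_extend (j := j)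
    (fun z => by simp [Collapse.extendZero_apply, Collapse.extendFun_of_mem hj.injective])
    (fun x hx => by simp [Collapse.extendZero_apply, Collapse.extendFun_of_notMem hjY _ hx])
  map_zero' := DFunLike.coe_injective <| Collapse.funext_extend (j := j)
    (fun z => by simp [Collapse.extendZero_apply, Collapse.extendFun_of_mem hj.injective])
    (fun x hx => by simp [Collapse.extendZero_apply, Collapse.extendFun_of_notMem hjY _ hx])
  map_add' f g := DFunLike.coe_injective <| Collapse.funext_extend (j := j)
    (fun z => by simp [Collapse.extendZero_apply, Collapse.extendFun_of_mem hj.injective])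
    (fun x hx => by simp [Collapse.extendZero_apply, Collapse.extendFun_of_notMem hjY _ hx])
  map_mul' f g := DFunLike.coe_injective <| Collapse.funext_extend (j := j)
    (fun z => by simp [Collapse.extendZero_apply, Collapse.extendFun_of_mem hj.injective])
    (fun x hx => by simp [Collapse.extendZero_apply, Collapse.extendFun_of_notMem hjY _ hx])
  map_star' f := DFunLike.coe_injective <| Collapse.funext_extend (j := j)
    (fun z => by simp [Collapse.extendZero_apply, Collapse.extendFun_of_mem hj.injective])
    (fun x hx => by simp [Collapse.extendZero_apply, Collapse.extendFun_of_notMem hjY _ hx])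

theorem Collapse.extend_apply (hj : Topology.IsOpenEmbedding j)
    (hjY : Disjoint (Set.range j) Y) (h : C₀(O, ℂ)) (x : Collapse Y) :
    Collapse.extend hj hjY h x = Collapse.extendFun hjY h x := rfl

/-- The restriction of `g` vanishes at infinity on `O`: the set where `‖g‖ ≥ ε` pulls back to a
compact subset of `X`, by properness of the projection, and it lies in the range of `j`. -/
theorem Collapse.exists_extend_eq (hY : IsCompact Y) (hj : Topology.IsOpenEmbedding j)
    (hjY : Disjoint (Set.range j) Y) (g : C₀(Collapse Y, ℂ))
    (hg : ∀ x ∉ Set.range j, g (Collapse.mk Y x) = 0) : ∃ h, Collapse.extend hj hjY h = g := by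
  have hq : Continuous (Collapse.mk Y) := Collapse.isQuotientMap_mk.continuous
  have hgq : Continuous fun x => g (Collapse.mk Y x) := (map_continuous g).comp hq
  refine ⟨⟨⟨fun z => g (Collapse.mk Y (j z)), hgq.comp hj.continuous⟩,
    tendsto_cocompact_nhds_zero fun ε hε => ?_⟩, DFunLike.coe_injective ?_⟩
  · obtain ⟨L, hL, hLg⟩ := g.exists_isCompact_norm_lt hε
    refine ⟨j ⁻¹' {x | ε ≤ ‖g (Collapse.mk Y x)‖}, ?_, fun z hz => not_le.1 hz⟩
    have hsub : {x | ε ≤ ‖g (Collapse.mk Y x)‖} ⊆ Set.range j := fun x hx => by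
      by_contra hx'
      have hx : ε ≤ ‖g (Collapse.mk Y x)‖ := hx
      rw [hg x hx', norm_zero] at hx
      exact absurd hε (not_lt.2 hx)
    rw [hj.isInducing.isCompact_iff, Set.image_preimage_eq_of_subset hsub]
    refine ((Collapse.isProperMap_mk hY.isClosed hY).isCompact_preimage hL).of_isClosed_subset
      (isClosed_le continuous_const hgq.norm) fun x hx => ?_
    by_contra hx'
    exact absurd (hLg _ hx') (not_lt.2 hx)
  · exact Collapse.funext_extend (j := j)
      (fun z => Collapse.extendFun_of_mem hj.injective hjY _ z)
      (fun x hx => (Collapse.extendFun_of_notMem hjY _ hx).trans (hg x hx).symm)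

end ExtendByZero

/-! ### The split exact sequence of a collapse -/

/-- A continuous surjection that is the identity off a compact set is a quotient map. -/
theorem isQuotientMap_of_eq_off_compact {X : Type*} [TopologicalSpace X] [T2Space X] {Φ : X → X}
    (hΦ : Continuous Φ) (hs : Function.Surjective Φ) {K : Set X} (hK : IsCompact K)
    (hid : ∀ x ∉ K, Φ x = x) : Topology.IsQuotientMap Φ := by
  refine IsClosedMap.isQuotientMap (fun C hC => ?_) hΦ hs
  -- Both pieces are closed: the first is compact, the second consists of the fixed points of `Φ` in
  -- `C`.
  have h : Φ '' C = Φ '' (K ∩ C) ∪ (C ∩ {x | Φ x = x}) := by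
    ext y
    constructor
    · rintro ⟨x, hx, rfl⟩
      by_cases hxK : x ∈ K
      · exact Or.inl ⟨x, ⟨hxK, hx⟩, rfl⟩
      · have hx' := hid x hxK
        exact Or.inr ⟨hx'.symm ▸ hx, congrArg Φ hx'⟩
    · rintro (⟨x, hx, rfl⟩ | hy)
      exacts [⟨x, hx.2, rfl⟩, ⟨y, hy.1, hy.2⟩]
  rw [h]
  exact ((hK.inter_right hC).image hΦ).isClosed.union (hC.inter (isClosed_eq hΦ continuous_id))

/-- If a self-map of `X`, the identity off a compact set, collapses exactly `D ∪ Y` to a point,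
then `C₀(X / Y)` is a split extension of `C₀(X)` by `C₀(D \ Y)`. -/
theorem exists_splitExact_collapse {X O : Type*} [TopologicalSpace X] [T2Space X]
    [TopologicalSpace O] {Y D K : Set X} {Φ : X → X} (hY : IsCompact Y) (hYn : Y.Nonempty)
    (hD : IsOpen D) (hDY : IsCompact (D ∪ Y)) (hΦ : Continuous Φ) (hs : Function.Surjective Φ)
    (hK : IsCompact K) (hid : ∀ x ∉ K, Φ x = x)
    (hfib : ∀ x y, Φ x = Φ y ↔ x = y ∨ (x ∈ D ∪ Y ∧ y ∈ D ∪ Y))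
    {j : O → X} (hj : Topology.IsOpenEmbedding j) (hjr : Set.range j = D \ Y) :
    ∃ (i : C₀(O, ℂ) →⋆ₙₐ[ℂ] C₀(Collapse Y, ℂ)) (p : C₀(Collapse Y, ℂ) →⋆ₙₐ[ℂ] C₀(X, ℂ))
      (s : C₀(X, ℂ) →⋆ₙₐ[ℂ] C₀(Collapse Y, ℂ)), CStarK.SplitExact i p s := by
  classical
  obtain ⟨y₀, hy₀⟩ := hYn
  have hq : Continuous (Collapse.mk Y) := Collapse.isQuotientMap_mk.continuous
  have hjY : Disjoint (Set.range j) Y := by rw [hjr]; exact Set.disjoint_sdiff_left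
  -- This is the section before descending along `Φ`. It is constant on the closed set `D ∪ Y` and
  -- equals the projection on the closed set `Dᶜ`; the two descriptions agree on the overlap.
  let τ : X → Collapse Y := fun x => if x ∈ D ∪ Y then Collapse.mk Y y₀ else Collapse.mk Y x
  have hτ₁ : ∀ x ∈ D ∪ Y, τ x = Collapse.mk Y y₀ := fun x hx => if_pos hx
  have hτ₂ : ∀ x ∉ D, τ x = Collapse.mk Y x := fun x hx => by
    by_cases h : x ∈ D ∪ Y
    · rw [hτ₁ x h]
      exact Collapse.mk_eq_mk.2 (Or.inr ⟨hy₀, h.resolve_left hx⟩)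
    · exact if_neg h
  have hτ : Continuous τ := by
    rw [← continuousOn_univ, ← Set.compl_union_self D]
    refine (ContinuousOn.union_of_isClosed (s := Dᶜ) (t := D ∪ Y)
      (hq.continuousOn.congr fun x hx => hτ₂ x hx)
      (continuousOn_const.congr fun x hx => hτ₁ x hx) hD.isClosed_compl hDY.isClosed).mono ?_
    exact Set.union_subset_union_right _ Set.subset_union_left
  have hΦq := isQuotientMap_of_eq_off_compact hΦ hs hK hid
  have hfac : Function.FactorsThrough τ Φ := fun x y hxy => by
    rcases (hfib x y).1 hxy with rfl | ⟨hx, hy⟩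
    · rfl
    · rw [hτ₁ x hx, hτ₁ y hy]
  let t : C(X, Collapse Y) := hΦq.lift (f := ⟨Φ, hΦ⟩) ⟨τ, hτ⟩ hfac
  have ht : ∀ x, t (Φ x) = τ x := fun x =>
    DFunLike.congr_fun (hΦq.lift_comp (f := ⟨Φ, hΦ⟩) ⟨τ, hτ⟩ hfac) x
  -- Properness: the preimage of a compact `L` lies in the image under `Φ` of the compact set formed
  -- by `D ∪ Y` and the preimage of `L` in `X`.
  let T : CocompactMap X (Collapse Y) :=
    { t with
      cocompact_tendsto' := by
        intro S hS
        obtain ⟨L, hL, hLS⟩ := Filter.mem_cocompact.1 hS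
        refine Filter.mem_cocompact.2 ⟨Φ '' (Collapse.mk Y ⁻¹' L ∪ (D ∪ Y)),
          (((Collapse.isProperMap_mk hY.isClosed hY).isCompact_preimage hL).union hDY).image hΦ,
          fun y hy => hLS fun hyL => ?_⟩
        obtain ⟨x, rfl⟩ := hs y
        have hyL : t (Φ x) ∈ L := hyL
        by_cases hx : x ∈ D ∪ Y
        · exact hy ⟨x, Or.inr hx, rfl⟩
        · rw [ht, hτ₂ x fun h => hx (Or.inl h)] at hyL
          exact hy ⟨x, Or.inl hyL, rfl⟩ }
  have hT : ∀ x, T (Φ x) = τ x := ht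
  have hΦY : ∀ x y, (CollapseSetoid Y).r x y → Φ x = Φ y := by
    rintro x y (rfl | ⟨hx, hy⟩)
    · rfl
    · exact (hfib x y).2 (Or.inr ⟨Or.inr hx, Or.inr hy⟩)
  -- Properness: a point of `X` mapped into `L` by `Φ` lies in `K` or, being fixed, in `L`.
  let P : CocompactMap (Collapse Y) X :=
    { toFun := Quotient.lift Φ hΦY
      continuous_toFun := hΦ.quotient_lift hΦY
      cocompact_tendsto' := by
        intro S hS
        obtain ⟨L, hL, hLS⟩ := Filter.mem_cocompact.1 hS
        refine Filter.mem_cocompact.2 ⟨Collapse.mk Y '' (L ∪ K), (hL.union hK).image hq,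
          fun z hz => hLS fun hzL => ?_⟩
        obtain ⟨x, rfl⟩ := Collapse.isQuotientMap_mk.surjective z
        have hzL : Φ x ∈ L := hzL
        by_cases hx : x ∈ K
        · exact hz ⟨x, Or.inr hx, rfl⟩
        · rw [hid x hx] at hzL
          exact hz ⟨x, Or.inl hzL, rfl⟩ }
  have hP : ∀ x, P (Collapse.mk Y x) = Φ x := fun _ => rfl
  have hPT : ∀ y, P (T y) = y := fun y => by
    obtain ⟨x, rfl⟩ := hs y
    rw [hT]
    by_cases hx : x ∈ D ∪ Y
    · rw [hτ₁ x hx, hP]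
      exact (hfib _ _).2 (Or.inr ⟨Or.inr hy₀, hx⟩)
    · rw [hτ₂ x fun h => hx (Or.inl h), hP]
  refine ⟨Collapse.extend hj hjY, ZeroAtInftyContinuousMap.pullback T,
    ZeroAtInftyContinuousMap.pullback P, ⟨?_, ?_, ?_, ?_⟩⟩
  · intro f g hfg
    refine DFunLike.ext _ _ fun z => ?_
    have := DFunLike.congr_fun hfg (Collapse.mk Y (j z))
    rwa [Collapse.extend_apply, Collapse.extend_apply, Collapse.extendFun_of_mem hj.injective,
      Collapse.extendFun_of_mem hj.injective] at this
  · exact fun b => DFunLike.ext _ _ fun y => congrArg b (hPT y)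
  · intro h
    refine DFunLike.ext _ _ fun y => ?_
    obtain ⟨x, rfl⟩ := hs y
    change Collapse.extendFun hjY h (T (Φ x)) = 0
    rw [hT]
    by_cases hx : x ∈ D ∪ Y
    · rw [hτ₁ x hx]
      exact Collapse.extendFun_of_notMem hjY h fun h' => Set.disjoint_left.1 hjY h' hy₀
    · have hx' : x ∉ D := fun h => hx (Or.inl h)
      rw [hτ₂ x hx']
      exact Collapse.extendFun_of_notMem hjY h fun h' => hx' (hjr ▸ h').1
  · intro g hg
    refine Collapse.exists_extend_eq hY hj hjY g fun x hx => ?_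
    -- A function in the kernel of `T*` vanishes on the range of `τ`, which contains the base point
    -- and the classes of all points outside `D`.
    have hg' : ∀ x, g (τ x) = 0 := fun x => by
      rw [← hT]
      exact DFunLike.congr_fun hg (Φ x)
    by_cases hxY : x ∈ Y
    · rw [← hg' x, hτ₁ x (Or.inr hxY)]
      exact congrArg g (Collapse.mk_eq_mk.2 (Or.inr ⟨hxY, hy₀⟩))
    · have hxD : x ∉ D := fun h => hx (by rw [hjr]; exact ⟨h, hxY⟩)
      rw [← hg' x, hτ₂ x hxD]

/-! ### The unit cube -/

/-- The affine homeomorphism carrying the unit cube to the unit ball of the supremum norm. -/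
noncomputable def cubeHomeomorph (m : ℕ) : EuclideanSpace ℝ (Fin m) ≃ₜ (Fin m → ℝ) where
  toFun x := fun i => 2 * x i - 1
  invFun w := WithLp.toLp 2 fun i => (w i + 1) / 2
  left_inv x := by ext i; simp
  right_inv w := by ext i; simp; ring
  continuous_toFun := by fun_prop
  continuous_invFun := by fun_prop

theorem cubeHomeomorph_apply {m : ℕ} (x : EuclideanSpace ℝ (Fin m)) (i : Fin m) :
    cubeHomeomorph m x i = 2 * x i - 1 := rfl

theorem openCube_eq_preimage_ball (m : ℕ) :
    openCube m = cubeHomeomorph m ⁻¹' Metric.ball 0 1 := by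
  ext x
  rw [Set.mem_preimage, mem_ball_zero_iff, pi_norm_lt_iff one_pos]
  refine forall_congr' fun i => ?_
  rw [cubeHomeomorph_apply, Real.norm_eq_abs, abs_lt]
  constructor <;> rintro ⟨h₁, h₂⟩ <;> constructor <;> linarith

theorem isOpen_openCube (m : ℕ) : IsOpen (openCube m) := by
  rw [openCube_eq_preimage_ball]
  exact Metric.isOpen_ball.preimage (cubeHomeomorph m).continuous

theorem closure_openCube (m : ℕ) :
    closure (openCube m) = cubeHomeomorph m ⁻¹' Metric.closedBall 0 1 := by
  rw [openCube_eq_preimage_ball, ← (cubeHomeomorph m).preimage_closure,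
    closure_ball _ one_ne_zero]

theorem isCompact_closure_openCube (m : ℕ) : IsCompact (closure (openCube m)) := by
  rw [closure_openCube, (cubeHomeomorph m).isCompact_preimage]
  exact isCompact_closedBall _ _

/-- The origin is a corner of the cube. For `m = 0` the cube is the whole space and has no frontier.
-/
theorem zero_mem_frontier_openCube {m : ℕ} (hm : 1 ≤ m) :
    (0 : EuclideanSpace ℝ (Fin m)) ∈ frontier (openCube m) := by
  rw [(isOpen_openCube m).frontier_eq]
  refine ⟨?_, fun h => lt_irrefl _ (h ⟨0, hm⟩).1⟩
  rw [closure_openCube, Set.mem_preimage, mem_closedBall_zero_iff,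
    pi_norm_le_iff_of_nonneg zero_le_one]
  intro i
  simp [cubeHomeomorph_apply]

/-! ### The collapse in the coordinate chart -/

theorem lemma2p5 {m : ℕ} (hm : 1 ≤ m)
    {M : Type*} [TopologicalSpace M] [T2Space M]
    [ChartedSpace (EuclideanSpace ℝ (Fin m)) M] [IsManifold (𝓡 m) ∞ M]
    (U : TopologicalSpace.Opens M) (φ : U ≃ₘ⟮𝓡 m, 𝓡 m⟯ EuclideanSpace ℝ (Fin m))
    (F : EuclideanSpace ℝ (Fin m) → ℝ) (hF : F ∈ FSpace m)
    (hZ₁ : frontier (openCube m) ⊆ zeroSet F) (hZ₂ : zeroSet F ⊆ closure (openCube m))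
    (Y : Set M) (hY : Y = Subtype.val '' (φ ⁻¹' (zeroSet F ∪ {0}))) :
    Nonempty (CStarK.K0 C₀(Collapse Y, ℂ) ≃+
      CStarK.K0 C₀(M, ℂ) × CStarK.K0 C₀(↥(openCube m \ zeroSet F), ℂ)) ∧
    Nonempty (CStarK.K1 C₀(Collapse Y, ℂ) ≃+
      CStarK.K1 C₀(M, ℂ) × CStarK.K1 C₀(↥(openCube m \ zeroSet F), ℂ)) := by
  let h : U ≃ₜ EuclideanSpace ℝ (Fin m) := φ.toHomeomorph
  have h0 : (0 : EuclideanSpace ℝ (Fin m)) ∈ zeroSet F := hZ₁ (zero_mem_frontier_openCube hm)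
  have hZ : IsClosed (zeroSet F) := isClosed_eq hF.1.continuous continuous_const
  have hcl : closure (openCube m) = openCube m ∪ zeroSet F := by
    refine Set.Subset.antisymm ?_ (Set.union_subset subset_closure hZ₂)
    rw [closure_eq_self_union_frontier]
    exact Set.union_subset_union_right _ hZ₁
  let c : EuclideanSpace ℝ (Fin m) → M := fun x => h.symm x
  have hc : Topology.IsOpenEmbedding c := U.isOpenEmbedding'.comp h.symm.isOpenEmbedding
  have himage : ∀ S : Set (EuclideanSpace ℝ (Fin m)), Subtype.val '' (h ⁻¹' S) = c '' S :=
    fun S => by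
      rw [← h.image_symm, Set.image_image]
  have hYc : Y = c '' zeroSet F := by
    rw [hY, Set.union_eq_self_of_subset_right (Set.singleton_subset_iff.2 h0)]
    exact himage _
  have hDY : c '' openCube m ∪ Y = c '' closure (openCube m) := by
    rw [hYc, hcl, Set.image_union]
  -- The chart is followed by `cubeHomeomorph m`, so that the collapsed unit ball is the closed
  -- cube, that is, `D ∪ Y`.
  obtain ⟨Φ, K, hΦ, hs, hK, hid, hfib⟩ := exists_collapse_ball U.isOpen
    (h.trans (cubeHomeomorph m))
  have hball : Subtype.val '' ((h.trans (cubeHomeomorph m)) ⁻¹' Metric.closedBall 0 1) =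
      c '' openCube m ∪ Y := by
    rw [hDY, closure_openCube, ← himage]
    rfl
  have hfib' : ∀ x y, Φ x = Φ y ↔
      x = y ∨ (x ∈ c '' openCube m ∪ Y ∧ y ∈ c '' openCube m ∪ Y) := fun x y => by
    rw [← hball]
    exact hfib x y
  have hj : Topology.IsOpenEmbedding fun z : ↥(openCube m \ zeroSet F) => c z :=
    hc.comp ((isOpen_openCube m).sdiff hZ).isOpenEmbedding_subtypeVal
  have hjr : Set.range (fun z : ↥(openCube m \ zeroSet F) => c z) = c '' openCube m \ Y := by
    rw [hYc, ← Set.image_sdiff hc.injective, Set.image_eq_range]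
  have hYcompact : IsCompact Y := by
    rw [hYc]
    exact ((isCompact_closure_openCube m).of_isClosed_subset hZ hZ₂).image hc.continuous
  have hYn : Y.Nonempty := by
    rw [hYc]
    exact ⟨_, 0, h0, rfl⟩
  have hDYc : IsCompact (c '' openCube m ∪ Y) := by
    rw [hDY]
    exact (isCompact_closure_openCube m).image hc.continuous
  obtain ⟨i, p, s, H⟩ := exists_splitExact_collapse hYcompact hYn
    (hc.isOpenMap _ (isOpen_openCube m)) hDYc hΦ hs hK hid hfib' hj hjr
  exact ⟨H.nonempty_K0_addEquiv, H.nonempty_K1_addEquiv⟩
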